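/- Let $d\ge 2$ be an integer and let $S^d$ be the unit sphere of $\mathbb{R}^{d+1}$, with $|xy|\in[0,2\pi]$ denoting twice the angle between $x,y\in S^d$, so that $\cos(|xy|/2)=x\cdot y$. A continuous function $f\colon[-1,1]\to\mathbb{R}$ is the isotropic part of a positive definite kernel on $S^d$ if the kernel $K(x,y)=f(\cos(|xy|/2))$ satisfies $\sum_{i,j=1}^n c_ic_jK(x_i,x_j)\ge 0$ for all $n\ge 1$, all distinct $x_1,\dots,x_n\in S^d$ and all real $c_1,\dots,c_n$; it is the isotropic part of a strictly positive definite kernel if moreover the inequality is strict whenever $c_1,\dots,c_n$ are not all zero. Let $C_k^{\lambda}$ denote the Gegenbauer polynomials. Let $f$ and $g$ be isotropic parts of positive definite kernels on $S^d$. Then $f$ and $g$ have representations $$f(t)=\sum_{k=0}^\infty a_k(f)\,C_k^{(d-1)/2}(t),\qquad g(t)=\sum_{k=0}^\infty a_k(g)\,C_k^{(d-1)/2}(t),\qquad t\in[-1,1],$$ with all coefficients nonnegative and both series convergent at $t=1$; and, for any such representations, the product $fg$ is the isotropic part of a strictly positive definite kernel on $S^d$ if and only if the set $$\{k+l : k,l\ge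 0,\ a_k(f)\,a_l(g)>0\}$$ contains infinitely many even and infinitely many odd integers. -/

import Mathlib

open scoped Polynomial

noncomputable section

/-- The unit sphere `S^d` in `ℝ^(d+1)`. -/
abbrev UnitSphere (d : ℕ) : Type :=
  Metric.sphere (0 : EuclideanSpace ℝ (Fin (d + 1))) 1

/-- The geodesic distance on `S^d`, normalized so that its maximal value is `2π`. -/
def sphereDist {d : ℕ} (x y : UnitSphere d) : ℝ :=
  2 * InnerProductGeometry.angle (x : EuclideanSpace ℝ (Fin (d + 1))) y

/-- The isotropic kernel `K(x, y) = f (cos (|xy| / 2))` on `S^d`. -/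
def isotropicKernel (d : ℕ) (f : ℝ → ℝ) (x y : UnitSphere d) : ℝ :=
  f (Real.cos (sphereDist x y / 2))

theorem isotropicKernel_eq_inner (d : ℕ) (f : ℝ → ℝ) (x y : UnitSphere d) :
    isotropicKernel d f x y =
      f (inner ℝ (x : EuclideanSpace ℝ (Fin (d + 1))) (y : EuclideanSpace ℝ (Fin (d + 1)))) := by
  have hx : ‖(x : EuclideanSpace ℝ (Fin (d + 1)))‖ = 1 := norm_eq_of_mem_sphere x
  have hy : ‖(y : EuclideanSpace ℝ (Fin (d + 1)))‖ = 1 := norm_eq_of_mem_sphere y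
  unfold isotropicKernel sphereDist
  rw [mul_div_cancel_left₀ _ (two_ne_zero' ℝ), InnerProductGeometry.cos_angle, hx, hy]
  simp

/-- `f` is continuous on `[-1, 1]` and is the isotropic part of a positive definite kernel
on `S^d`. Values of `f` outside `[-1, 1]` play no role. -/
def IsIsotropicPartPD (d : ℕ) (f : ℝ → ℝ) : Prop :=
  ContinuousOn f (Set.Icc (-1) 1) ∧
    ∀ (n : ℕ) (x : Fin n → UnitSphere d), Function.Injective x → ∀ c : Fin n → ℝ,
      0 ≤ ∑ i, ∑ j, c i * c j * isotropicKernel d f (x i) (x j)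

/-- `f` is continuous on `[-1, 1]` and is the isotropic part of a strictly positive definite
kernel on `S^d`. -/
def IsIsotropicPartSPD (d : ℕ) (f : ℝ → ℝ) : Prop :=
  IsIsotropicPartPD d f ∧
    ∀ (n : ℕ) (x : Fin n → UnitSphere d), Function.Injective x → ∀ c : Fin n → ℝ, c ≠ 0 →
      0 < ∑ i, ∑ j, c i * c j * isotropicKernel d f (x i) (x j)

/-- The Gegenbauer polynomials `C_k^lam`, by their three-term recurrence
`(k+2) C_{k+2}(t) = 2 (k+1+lam) t C_{k+1}(t) - (k+2 lam) C_k(t)`. For `lam > 0`, `C_k^lam` is a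
positive multiple of the Jacobi polynomial with both exponents equal to `lam - 1/2`. -/
def gegenbauerPoly (lam : ℝ) : ℕ → ℝ[X]
  | 0 => 1
  | 1 => Polynomial.C (2 * lam) * Polynomial.X
  | k + 2 =>
      Polynomial.C (1 / ((k : ℝ) + 2)) *
        (Polynomial.C (2 * ((k : ℝ) + 1 + lam)) * Polynomial.X * gegenbauerPoly lam (k + 1) -
          Polynomial.C ((k : ℝ) + 2 * lam) * gegenbauerPoly lam k)

/-- `a` is the coefficient sequence of a representation
`f(t) = ∑ a_k C_k^((d-1)/2)(t)`, `t ∈ [-1, 1]`, with all `a_k ≥ 0` and the series convergent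
on `[-1, 1]` (in particular at `t = 1`). -/
def IsGegenbauerExpansion (d : ℕ) (f : ℝ → ℝ) (a : ℕ → ℝ) : Prop :=
  (∀ k, 0 ≤ a k) ∧
    ∀ t ∈ Set.Icc (-1 : ℝ) 1,
      HasSum (fun k => a k * (gegenbauerPoly (((d : ℝ) - 1) / 2) k).eval t) (f t)

/-- The set `{k + l : a_k b_l > 0}`. -/
def sumSupport (a b : ℕ → ℝ) : Set ℕ :=
  {m | ∃ k l : ℕ, 0 < a k * b l ∧ m = k + l}

end

open Polynomial Filter Topology

/-! ### Gegenbauer polynomials -/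

section Gegenbauer

variable {lam : ℝ}

/-! The kernel is `f` of the inner product. By Schur's product theorem, every product `C_k C_l` of
Gegenbauer polynomials gives a positive definite kernel, and the quadratic form of `f g` is the sum
of the forms of `C_k C_l` with weights `a_k b_l ≥ 0`. Hence it vanishes at a vector `c` exactly when
each form with `a_k b_l > 0` does.

Sufficiency. A null vector of a positive semidefinite form lies in the kernel of its matrix. After
normalization at `1`, the entries of the matrix of `C_k C_l` are `1` for equal points and
`(-1)^(k+l)` for antipodal points, and they tend to `0` for all other pairs as `k + l → ∞`
(`tendsto_ratio_mul_ratio`). Letting `k + l → ∞` through even values gives `c_i + c_{i'} = 0`, where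
`i'` is the antipode of `i` if present; odd values give `c_i - c_{i'} = 0`. So `c = 0`.

Necessity. Suppose the degrees of one parity are bounded. Take many points of a half great circle,
with weights killing all moments of low degree, and copy the weights to the antipodes with the sign
of that parity. Terms of the opposite parity cancel between antipodes and terms of the bounded
parity are killed by the moments, so the form vanishes (`not_isIsotropicPartSPD_mul`).

Existence of expansions is Schoenberg's theorem. The means of `f C_k` are nonnegative because `f
C_k` is positive definite, the coefficient series is bounded at `1` by testing against the peaks
`((1+t)/2)^n`, and completeness identifies the sum with `f`. Positive definiteness of `C_k` comes
from the reproducing property of zonal harmonics under the Fischer inner product; orthogonality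
comes from the Gegenbauer differential equation. -/

theorem gegenbauerPoly_rec (lam : ℝ) (k : ℕ) :
    ((k : ℝ[X]) + 2) * gegenbauerPoly lam (k + 2) =
      2 * ((k : ℝ[X]) + 1 + C lam) * X * gegenbauerPoly lam (k + 1) -
        ((k : ℝ[X]) + 2 * C lam) * gegenbauerPoly lam k := by
  have h : ((k : ℝ[X]) + 2) * C (1 / ((k : ℝ) + 2)) = 1 := by
    have : ((k : ℝ[X]) + 2) = C ((k : ℝ) + 2) := by
      simp only [map_add, map_natCast, map_ofNat]
    rw [this, ← C_mul, mul_one_div_cancel (by positivity), C_1]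
  rw [gegenbauerPoly, ← mul_assoc, h, one_mul]
  simp only [map_mul, map_add, map_natCast, map_one, map_ofNat]

theorem gegenbauerPoly_eval_rec (lam : ℝ) (k : ℕ) (t : ℝ) :
    ((k : ℝ) + 2) * (gegenbauerPoly lam (k + 2)).eval t =
      2 * ((k : ℝ) + 1 + lam) * t * (gegenbauerPoly lam (k + 1)).eval t -
        ((k : ℝ) + 2 * lam) * (gegenbauerPoly lam k).eval t := by
  simpa using congrArg (eval t) (gegenbauerPoly_rec lam k)

@[simp] theorem gegenbauerPoly_zero (lam : ℝ) : gegenbauerPoly lam 0 = 1 := by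
  rw [gegenbauerPoly]

theorem gegenbauerPoly_one (lam : ℝ) : gegenbauerPoly lam 1 = 2 * C lam * X := by
  rw [gegenbauerPoly, C_mul, map_ofNat]

theorem gegenbauerPoly_eval_neg (lam : ℝ) (t : ℝ) (k : ℕ) :
    (gegenbauerPoly lam k).eval (-t) = (-1) ^ k * (gegenbauerPoly lam k).eval t := by
  induction k using Nat.twoStepInduction with
  | zero => simp
  | one => simp [gegenbauerPoly_one]
  | more k h0 h1 =>
    have hk : ((k : ℝ) + 2) ≠ 0 := by positivity
    apply mul_left_cancel₀ hk
    rw [mul_left_comm, gegenbauerPoly_eval_rec, gegenbauerPoly_eval_rec, h0, h1]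
    ring

theorem gegenbauerPoly_eval_one_succ (lam : ℝ) (k : ℕ) :
    ((k : ℝ) + 1) * (gegenbauerPoly lam (k + 1)).eval 1 =
      ((k : ℝ) + 2 * lam) * (gegenbauerPoly lam k).eval 1 := by
  induction k with
  | zero => simp [gegenbauerPoly_one]
  | succ k ih =>
    have := gegenbauerPoly_eval_rec lam k 1
    push_cast
    linear_combination this + ih

theorem gegenbauerPoly_eval_one_pos (hl : 0 < lam) (k : ℕ) :
    0 < (gegenbauerPoly lam k).eval 1 := by
  induction k with
  | zero => simp
  | succ k ih =>
    have h := gegenbauerPoly_eval_one_succ lam k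
    have : 0 < ((k : ℝ) + 1) * (gegenbauerPoly lam (k + 1)).eval 1 := by
      rw [h]; positivity
    exact pos_of_mul_pos_right this (by positivity)

/-! ### Bounds and decay of the normalized Gegenbauer polynomials -/

/-- The Gegenbauer polynomials normalized to take the value `1` at `1`. -/
noncomputable def gegenbauerRatio (lam : ℝ) (k : ℕ) (t : ℝ) : ℝ :=
  (gegenbauerPoly lam k).eval t / (gegenbauerPoly lam k).eval 1

theorem gegenbauerRatio_rec (hl : 0 < lam) (k : ℕ) (t : ℝ) :
    ((k : ℝ) + 1 + 2 * lam) * gegenbauerRatio lam (k + 2) t =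
      2 * ((k : ℝ) + 1 + lam) * t * gegenbauerRatio lam (k + 1) t -
        ((k : ℝ) + 1) * gegenbauerRatio lam k t := by
  unfold gegenbauerRatio
  have p0 := gegenbauerPoly_eval_one_pos hl k
  have e1 := gegenbauerPoly_eval_one_succ lam k
  have e2 := gegenbauerPoly_eval_one_succ lam (k + 1)
  have r := gegenbauerPoly_eval_rec lam k t
  push_cast at e2
  have f1 : (gegenbauerPoly lam (k + 1)).eval 1 =
      ((k : ℝ) + 2 * lam) / (k + 1) * (gegenbauerPoly lam k).eval 1 := by
    field_simp; linear_combination e1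
  have f2 : (gegenbauerPoly lam (k + 2)).eval 1 =
      ((k : ℝ) + 1 + 2 * lam) / (k + 2) *
        (((k : ℝ) + 2 * lam) / (k + 1) * (gegenbauerPoly lam k).eval 1) := by
    rw [← f1]; field_simp; linear_combination e2
  have f3 : (gegenbauerPoly lam (k + 2)).eval t =
      (2 * ((k : ℝ) + 1 + lam) * t * (gegenbauerPoly lam (k + 1)).eval t -
        ((k : ℝ) + 2 * lam) * (gegenbauerPoly lam k).eval t) / (k + 2) := by
    field_simp; linear_combination r
  rw [f2, f3, f1]
  have : 0 < (k : ℝ) + 2 * lam := by positivity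
  field_simp

/-- An energy that decreases along the three-term recurrence of the normalized Gegenbauer
polynomials. -/
noncomputable def gegenbauerEnergy (lam t : ℝ) (n : ℕ) : ℝ :=
  (gegenbauerRatio lam n t - t * gegenbauerRatio lam (n + 1) t) ^ 2 +
    (1 - t ^ 2) * gegenbauerRatio lam (n + 1) t ^ 2

/-- The energy is the quadratic form `v² - 2tuv + u²` in two consecutive values, symmetric in them,
so its next value is `(w - tu)² + (1 - t²)u²`. With `e = lam / (n + 1 + 2 lam)` the recurrence says
that `w - tu` is `tu - v` damped by `1 - 2e`. The loss factor `1 - (1 - 2e)² = 4e(1 - e)` is at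
least `2e`, since `e ≤ 1/2`. -/
theorem gegenbauerEnergy_succ_le (hl : 0 < lam) (t : ℝ) (n : ℕ) :
    gegenbauerEnergy lam t (n + 1) ≤ gegenbauerEnergy lam t n -
      2 * lam / ((n : ℝ) + 1 + 2 * lam) *
        (gegenbauerRatio lam n t - t * gegenbauerRatio lam (n + 1) t) ^ 2 := by
  have hr := gegenbauerRatio_rec hl n t
  unfold gegenbauerEnergy
  set u := gegenbauerRatio lam (n + 1) t
  set v := gegenbauerRatio lam n t
  set w := gegenbauerRatio lam (n + 1 + 1) t
  set D : ℝ := (n : ℝ) + 1 + 2 * lam with hD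
  have hDpos : 0 < D := by positivity
  set e := lam / D with he
  have heD : e * D = lam := div_mul_cancel₀ _ hDpos.ne'
  have he0 : 0 ≤ e := by positivity
  have he1 : e ≤ 1 / 2 := by
    rw [he, div_le_iff₀ hDpos, hD]; nlinarith [(Nat.cast_nonneg n : (0 : ℝ) ≤ n)]
  have hw : w = t * u + (1 - 2 * e) * (t * u - v) := by
    apply mul_left_cancel₀ hDpos.ne'
    have hr' : D * w = 2 * (D - lam) * t * u - (D - 2 * lam) * v := by
      rw [hD]; linear_combination hr
    rw [hr']
    linear_combination (2 * t * u - 2 * v) * heD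
  have h2 : 2 * lam / D = 2 * e := by rw [he]; ring
  rw [h2]
  have key : (u - t * w) ^ 2 + (1 - t ^ 2) * w ^ 2 =
      (1 - 2 * e) ^ 2 * (v - t * u) ^ 2 + (1 - t ^ 2) * u ^ 2 := by
    rw [hw]; ring
  rw [key]
  have : 0 ≤ (e * (1 - 2 * e)) * (v - t * u) ^ 2 :=
    mul_nonneg (mul_nonneg he0 (by linarith)) (sq_nonneg _)
  nlinarith

theorem gegenbauerEnergy_antitone (hl : 0 < lam) (t : ℝ) :
    Antitone (gegenbauerEnergy lam t) := by
  refine antitone_nat_of_succ_le fun n => (gegenbauerEnergy_succ_le hl t n).trans ?_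
  have : 0 ≤ 2 * lam / ((n : ℝ) + 1 + 2 * lam) *
        (gegenbauerRatio lam n t - t * gegenbauerRatio lam (n + 1) t) ^ 2 := by positivity
  linarith

theorem gegenbauerRatio_zero (lam t : ℝ) : gegenbauerRatio lam 0 t = 1 := by
  simp [gegenbauerRatio]

theorem gegenbauerRatio_one (hl : 0 < lam) (t : ℝ) : gegenbauerRatio lam 1 t = t := by
  simp only [gegenbauerRatio, gegenbauerPoly_one]
  simp; field_simp

theorem gegenbauerRatio_apply_one (hl : 0 < lam) (k : ℕ) : gegenbauerRatio lam k 1 = 1 :=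
  div_self (gegenbauerPoly_eval_one_pos hl k).ne'

theorem gegenbauerRatio_apply_neg_one (hl : 0 < lam) (k : ℕ) :
    gegenbauerRatio lam k (-1) = (-1) ^ k := by
  rw [gegenbauerRatio, gegenbauerPoly_eval_neg, mul_div_assoc,
    div_self (gegenbauerPoly_eval_one_pos hl k).ne', mul_one]

/-- For `|t| < 1` the energy starts at `1 - t²` and dominates `(1 - t²)` times the square of the
next ratio. At `t = ±1` this degenerates, but the values there are explicit. -/
theorem abs_gegenbauerRatio_le_one (hl : 0 < lam) {t : ℝ} (ht : t ∈ Set.Icc (-1 : ℝ) 1) (k : ℕ) :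
    |gegenbauerRatio lam k t| ≤ 1 := by
  rcases eq_or_lt_of_le ht.2 with rfl | h1
  · simp [gegenbauerRatio_apply_one hl]
  rcases eq_or_lt_of_le ht.1 with rfl | h2
  · simp [gegenbauerRatio_apply_neg_one hl]
  rcases k with _ | k
  · simp [gegenbauerRatio_zero]
  have h := gegenbauerEnergy_antitone hl t (Nat.zero_le k)
  have hpos : 0 < 1 - t ^ 2 := by nlinarith
  have h0 : gegenbauerEnergy lam t 0 = 1 - t ^ 2 := by
    simp only [gegenbauerEnergy, gegenbauerRatio_zero, zero_add, gegenbauerRatio_one hl]; ring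
  rw [h0, gegenbauerEnergy] at h
  rw [← sq_le_one_iff_abs_le_one]
  nlinarith [sq_nonneg (gegenbauerRatio lam k t - t * gegenbauerRatio lam (k + 1) t)]

theorem abs_gegenbauerPoly_eval_le (hl : 0 < lam) {t : ℝ} (ht : t ∈ Set.Icc (-1 : ℝ) 1) (k : ℕ) :
    |(gegenbauerPoly lam k).eval t| ≤ (gegenbauerPoly lam k).eval 1 := by
  have h := abs_gegenbauerRatio_le_one hl ht k
  have p := gegenbauerPoly_eval_one_pos hl k
  rwa [gegenbauerRatio, abs_div, abs_of_pos p, div_le_one p] at h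

/-- The energy lost at step `n` is of order `1/n` times `s n ^ 2`, and two consecutive `s` control
the whole energy. An energy bounded away from `0` would thus lose a divergent harmonic series. -/
theorem tendsto_gegenbauerEnergy (hl : 0 < lam) {t : ℝ} (h1 : -1 < t) (h2 : t < 1) :
    Tendsto (gegenbauerEnergy lam t) atTop (𝓝 0) := by
  have hpos : 0 < 1 - t ^ 2 := by nlinarith
  set E := gegenbauerEnergy lam t with hE
  set s : ℕ → ℝ := fun n => gegenbauerRatio lam n t - t * gegenbauerRatio lam (n + 1) t with hs
  have hE0 : ∀ n, 0 ≤ E n := fun n => by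
    simp only [hE, gegenbauerEnergy]; positivity
  have hanti := gegenbauerEnergy_antitone hl t
  set B : ℝ := 1 + 2 / (1 - t ^ 2) with hB
  have hBpos : 0 < B := by positivity
  -- two consecutive energy losses control the energy
  have hctrl : ∀ n, E n ≤ B * (s n ^ 2 + s (n + 1) ^ 2) := by
    intro n
    have hr := gegenbauerRatio_rec hl n t
    have hEn : E n = s n ^ 2 + (1 - t ^ 2) * gegenbauerRatio lam (n + 1) t ^ 2 := rfl
    have hs0 : s n = gegenbauerRatio lam n t - t * gegenbauerRatio lam (n + 1) t := rfl
    have hs1 : s (n + 1) = gegenbauerRatio lam (n + 1) t - t * gegenbauerRatio lam (n + 2) t := rfl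
    set u := gegenbauerRatio lam (n + 1) t
    set v := gegenbauerRatio lam n t
    set w := gegenbauerRatio lam (n + 2) t
    set a := s n
    set b := s (n + 1)
    have hDpos : 0 < (n : ℝ) + 1 + 2 * lam := by positivity
    set q := ((n : ℝ) + 1) / ((n : ℝ) + 1 + 2 * lam) with hq
    have hqD : q * ((n : ℝ) + 1 + 2 * lam) = n + 1 := div_mul_cancel₀ _ hDpos.ne'
    have hq0 : 0 ≤ q := by positivity
    have hq1 : q ≤ 1 := by rw [hq, div_le_one hDpos]; linarith
    have hw : w = t * u - q * a := by
      apply mul_left_cancel₀ hDpos.ne'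
      rw [hr, hs0]
      linear_combination (v - t * u) * hqD
    have hu : (1 - t ^ 2) * u = b - t * q * a := by rw [hs1, hw]; ring
    have htq : (t * q) ^ 2 ≤ 1 := by
      have : q ^ 2 ≤ 1 := by nlinarith
      have : t ^ 2 * q ^ 2 ≤ 1 * 1 := by gcongr; nlinarith
      nlinarith
    have hsq : ((1 - t ^ 2) * u) ^ 2 ≤ 2 * (a ^ 2 + b ^ 2) := by
      rw [hu]
      nlinarith [sq_nonneg (b + t * q * a), mul_le_mul_of_nonneg_right htq (sq_nonneg a)]
    have : (1 - t ^ 2) * u ^ 2 ≤ 2 / (1 - t ^ 2) * (a ^ 2 + b ^ 2) := by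
      rw [div_mul_eq_mul_div, le_div_iff₀ hpos]
      nlinarith
    rw [hEn, hB]
    nlinarith [sq_nonneg b]
  -- Both loss factors are at least `2 lam / (n + 2 + 2 lam)`, which is bounded below by a multiple
  -- of `1/(n + 1)` because `n + 2 + 2 lam ≤ (2 + 2 lam)(n + 1)`.
  have hdrop : ∀ n, E (n + 2) ≤ E n - 2 * lam / (2 + 2 * lam) * (1 / ((n : ℝ) + 1)) * (E n / B) := by
    intro n
    have e1 := gegenbauerEnergy_succ_le hl t n
    have e2 := gegenbauerEnergy_succ_le hl t (n + 1)
    change E (n + 1) ≤ E n - _ * s n ^ 2 at e1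
    change E (n + 2) ≤ E (n + 1) - _ * s (n + 1) ^ 2 at e2
    have hκ : 2 * lam / (2 + 2 * lam) * (1 / ((n : ℝ) + 1)) ≤
        2 * lam / (((n + 1 : ℕ) : ℝ) + 1 + 2 * lam) := by
      rw [div_mul_div_comm, mul_one]
      apply div_le_div_of_nonneg_left (by positivity) (by positivity)
      push_cast
      nlinarith [(Nat.cast_nonneg n : (0 : ℝ) ≤ n), mul_nonneg (Nat.cast_nonneg n : (0 : ℝ) ≤ n) hl.le]
    have hη : 2 * lam / (((n + 1 : ℕ) : ℝ) + 1 + 2 * lam) ≤ 2 * lam / ((n : ℝ) + 1 + 2 * lam) := by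
      apply div_le_div_of_nonneg_left (by positivity) (by positivity)
      push_cast; linarith
    have hc : E n / B ≤ s n ^ 2 + s (n + 1) ^ 2 := by
      rw [div_le_iff₀ hBpos, mul_comm]; exact hctrl n
    have m1 := mul_le_mul_of_nonneg_right hη (sq_nonneg (s n))
    have m2 := mul_le_mul_of_nonneg_left hc
      (by positivity : 0 ≤ 2 * lam / (2 + 2 * lam) * (1 / ((n : ℝ) + 1)))
    have m3 := mul_le_mul_of_nonneg_right hκ (by positivity : 0 ≤ s n ^ 2 + s (n + 1) ^ 2)
    nlinarith
  -- The drop spans two indices, so the telescoping sum leaves two boundary terms at each end.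
  have hsum : ∀ e, (∀ n, e ≤ E n) → ∀ N : ℕ,
      2 * lam / (2 + 2 * lam) * (e / B) * ∑ n ∈ Finset.range N, 1 / ((n : ℝ) + 1) ≤
        E 0 + E 1 - (E N + E (N + 1)) := by
    intro e he N
    induction N with
    | zero => simp
    | succ N ih =>
      rw [Finset.sum_range_succ, mul_add]
      have h1 := hdrop N
      have h2 : 2 * lam / (2 + 2 * lam) * (1 / ((N : ℝ) + 1)) * (e / B) ≤
          2 * lam / (2 + 2 * lam) * (1 / ((N : ℝ) + 1)) * (E N / B) := by
        gcongr; exact he N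
      have h3 : N + 1 + 1 = N + 2 := rfl
      rw [h3]
      linarith
  rw [Metric.tendsto_atTop]
  intro e he
  obtain ⟨N, hN⟩ : ∃ N, E N < e := by
    by_contra! hcon
    have hdiv := Real.tendsto_sum_range_one_div_nat_succ_atTop.const_mul_atTop
      (by positivity : 0 < 2 * lam / (2 + 2 * lam) * (e / B))
    obtain ⟨N, hN⟩ := (hdiv.eventually_gt_atTop (E 0 + E 1)).exists
    have := hsum e hcon N
    linarith [hE0 N, hE0 (N + 1)]
  refine ⟨N, fun n hn => ?_⟩
  rw [Real.dist_eq, sub_zero, abs_of_nonneg (hE0 n)]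
  exact (hanti hn).trans_lt hN

theorem tendsto_gegenbauerRatio (hl : 0 < lam) {t : ℝ} (h1 : -1 < t) (h2 : t < 1) :
    Tendsto (fun k => gegenbauerRatio lam k t) atTop (𝓝 0) := by
  have hpos : 0 < 1 - t ^ 2 := by nlinarith
  rw [← tendsto_add_atTop_iff_nat 1]
  have hE := (tendsto_gegenbauerEnergy hl h1 h2).div_const (1 - t ^ 2)
  rw [zero_div] at hE
  have hsq : Tendsto (fun k => gegenbauerRatio lam (k + 1) t ^ 2) atTop (𝓝 0) := by
    refine squeeze_zero (fun _ => sq_nonneg _) (fun k => ?_) hE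
    rw [le_div_iff₀ hpos, gegenbauerEnergy]
    nlinarith [sq_nonneg (gegenbauerRatio lam k t - t * gegenbauerRatio lam (k + 1) t)]
  rw [tendsto_zero_iff_abs_tendsto_zero]
  simpa [Function.comp_def, Real.sqrt_sq_eq_abs] using hsq.sqrt

/-! ### Differential equation and span of the Gegenbauer polynomials -/

/-- The two identities need a joint induction: differentiating the recurrence and using the second
gives the next first one, and this with the recurrence and both old identities gives the next second
one. Eliminating between them yields the differential equation. -/
theorem derivative_gegenbauerPoly_aux (lam : ℝ) (k : ℕ) :
    derivative (gegenbauerPoly lam (k + 1)) =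
      X * derivative (gegenbauerPoly lam k) + ((k : ℝ[X]) + 2 * C lam) * gegenbauerPoly lam k ∧
    X * derivative (gegenbauerPoly lam (k + 1)) =
      derivative (gegenbauerPoly lam k) + ((k : ℝ[X]) + 1) * gegenbauerPoly lam (k + 1) := by
  induction k with
  | zero => simp [gegenbauerPoly_one]; ring
  | succ k ih =>
    obtain ⟨hQ, hP⟩ := ih
    have hk : ((k : ℝ[X]) + 2) ≠ 0 := by
      have : ((k : ℝ[X]) + 2) = ((k + 2 : ℕ) : ℝ[X]) := by push_cast; ring
      rw [this]; exact Nat.cast_ne_zero.2 (by omega)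
    have hrec := gegenbauerPoly_rec lam k
    have hd := congrArg derivative hrec
    simp only [derivative_mul, derivative_sub, derivative_add, derivative_natCast, derivative_ofNat,
      derivative_one, derivative_C, derivative_X] at hd
    have hQ' : derivative (gegenbauerPoly lam (k + 1 + 1)) =
      X * derivative (gegenbauerPoly lam (k + 1)) +
        (((k + 1 : ℕ) : ℝ[X]) + 2 * C lam) * gegenbauerPoly lam (k + 1) := by
      apply mul_left_cancel₀ hk
      push_cast
      linear_combination hd + ((k : ℝ[X]) + 2 * C lam) * hP
    refine ⟨hQ', ?_⟩
    push_cast at hQ' ⊢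
    linear_combination X * hQ' - hrec + X * hP - hQ

theorem gegenbauerPoly_ode (lam : ℝ) (k : ℕ) :
    (1 - X ^ 2) * derivative (derivative (gegenbauerPoly lam k)) -
      (2 * C lam + 1) * X * derivative (gegenbauerPoly lam k) =
      -((k : ℝ[X]) * ((k : ℝ[X]) + 2 * C lam)) * gegenbauerPoly lam k := by
  rcases k with _ | k
  · simp
  obtain ⟨hQ, hP⟩ := derivative_gegenbauerPoly_aux lam k
  have h : (1 - X ^ 2) * derivative (gegenbauerPoly lam (k + 1)) =
      ((k : ℝ[X]) + 2 * C lam) * gegenbauerPoly lam k -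
        ((k : ℝ[X]) + 1) * X * gegenbauerPoly lam (k + 1) := by
    linear_combination hQ - X * hP
  have hd := congrArg derivative h
  simp only [derivative_mul, derivative_sub, derivative_add, derivative_natCast, derivative_ofNat,
    derivative_one, derivative_C, derivative_X, derivative_X_pow] at hd
  push_cast at hd ⊢
  simp only [map_ofNat] at hd
  linear_combination hd - ((k : ℝ[X]) + 2 * C lam) * hP

/-- The recurrence expresses `X C_k` through its neighbours, so the span contains `1` and is stable
under multiplication by `X`. -/
theorem span_gegenbauerPoly (hl : 0 < lam) :
    Submodule.span ℝ (Set.range (gegenbauerPoly lam)) = ⊤ := by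
  set S := Submodule.span ℝ (Set.range (gegenbauerPoly lam)) with hS
  have hmem : ∀ k, gegenbauerPoly lam k ∈ S := fun k => Submodule.subset_span ⟨k, rfl⟩
  have hXk : ∀ k, X * gegenbauerPoly lam k ∈ S := by
    intro k
    rcases k with _ | k
    · have : X * gegenbauerPoly lam 0 = (1 / (2 * lam)) • gegenbauerPoly lam 1 := by
        rw [gegenbauerPoly, gegenbauerPoly, smul_eq_C_mul, ← mul_assoc, ← C_mul,
          one_div_mul_cancel (by positivity)]
        simp
      rw [this]; exact S.smul_mem _ (hmem 1)
    · have : X * gegenbauerPoly lam (k + 1) = (1 / (2 * ((k : ℝ) + 1 + lam))) •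
          (((k : ℝ) + 2) • gegenbauerPoly lam (k + 2) +
            ((k : ℝ) + 2 * lam) • gegenbauerPoly lam k) := by
        have h := gegenbauerPoly_rec lam k
        simp only [smul_eq_C_mul]
        have e : C ((k : ℝ) + 2) * gegenbauerPoly lam (k + 2) +
            C ((k : ℝ) + 2 * lam) * gegenbauerPoly lam k =
            C (2 * ((k : ℝ) + 1 + lam)) * (X * gegenbauerPoly lam (k + 1)) := by
          simp only [map_add, map_mul, map_natCast, map_ofNat, map_one]
          linear_combination h
        rw [e, ← mul_assoc, ← C_mul, one_div_mul_cancel (by positivity), C_1, one_mul]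
      rw [this]
      exact S.smul_mem _ (S.add_mem (S.smul_mem _ (hmem _)) (S.smul_mem _ (hmem _)))
  have hX : ∀ p ∈ S, X * p ∈ S := by
    intro p hp
    induction hp using Submodule.span_induction with
    | mem p hp => obtain ⟨k, rfl⟩ := hp; exact hXk k
    | zero => simp
    | add p q _ _ hp hq => rw [mul_add]; exact S.add_mem hp hq
    | smul a p _ hp => rw [mul_smul_comm]; exact S.smul_mem _ hp
  have hpow : ∀ n : ℕ, (X : ℝ[X]) ^ n ∈ S := by
    intro n
    induction n with
    | zero => simpa using hmem 0
    | succ n ih => rw [pow_succ']; exact hX _ ih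
  rw [eq_top_iff]
  intro p _
  rw [p.as_sum_range_C_mul_X_pow]
  refine Submodule.sum_mem _ fun i _ => ?_
  rw [← smul_eq_C_mul]
  exact S.smul_mem _ (hpow i)

end Gegenbauer

/-! ### The Fischer inner product and zonal harmonic polynomials -/

namespace MvPolynomial

variable {σ : Type*} [Fintype σ]

/-- The Fischer inner product `⟨p, q⟩ = ∑ m, m! p_m q_m`. -/
noncomputable def fischer : MvPolynomial σ ℝ →ₗ[ℝ] MvPolynomial σ ℝ →ₗ[ℝ] ℝ :=
  (basisMonomials σ ℝ).constr ℝ fun m => (∏ j, ((m j).factorial : ℝ)) • lcoeff ℝ m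

theorem fischer_monomial (m : σ →₀ ℕ) (a : ℝ) (q : MvPolynomial σ ℝ) :
    fischer (monomial m a) q = a * ((∏ j, ((m j).factorial : ℝ)) * coeff m q) := by
  have h : monomial m a = a • basisMonomials σ ℝ m := by
    simp [coe_basisMonomials, smul_monomial]
  rw [h, map_smul, fischer, Module.Basis.constr_basis]
  simp

theorem fischer_self_nonneg (p : MvPolynomial σ ℝ) : 0 ≤ fischer p p := by
  have h : fischer p p = ∑ m ∈ p.support,
      coeff m p * ((∏ j, ((m j).factorial : ℝ)) * coeff m p) := by
    conv_lhs => enter [1, 2]; rw [p.as_sum]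
    simp only [map_sum, LinearMap.sum_apply, fischer_monomial]
  rw [h]
  refine Finset.sum_nonneg fun m _ => ?_
  have : 0 ≤ (∏ j, ((m j).factorial : ℝ)) * (coeff m p * coeff m p) :=
    mul_nonneg (Finset.prod_nonneg fun _ _ => by positivity) (mul_self_nonneg _)
  linarith

/-- The factorial weights are chosen to make multiplication by a variable adjoint to
differentiation. Consequently `linForm y` is adjoint to `dirDeriv y`, and `normSqForm` to the
Laplacian. -/
theorem fischer_X_mul (i : σ) (p q : MvPolynomial σ ℝ) :
    fischer (X i * p) q = fischer p (pderiv i q) := by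
  classical
  induction p using MvPolynomial.induction_on' with
  | add p r hp hr => simp [mul_add, hp, hr]
  | monomial m a =>
    have hX : (X i : MvPolynomial σ ℝ) * monomial m a = monomial (m + Finsupp.single i 1) a := by
      rw [X, monomial_mul, one_mul, add_comm]
    rw [hX, fischer_monomial, fischer_monomial, coeff_pderiv]
    have hf : (∏ j, (((m + Finsupp.single i 1 : σ →₀ ℕ) j).factorial : ℝ)) =
        ((m i : ℝ) + 1) * ∏ j, ((m j).factorial : ℝ) := by
      rw [← Finset.mul_prod_erase _ _ (Finset.mem_univ i),
        ← Finset.mul_prod_erase _ (fun j => ((m j).factorial : ℝ)) (Finset.mem_univ i)]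
      have : ∏ j ∈ Finset.univ.erase i, (((m + Finsupp.single i 1 : σ →₀ ℕ) j).factorial : ℝ) =
          ∏ j ∈ Finset.univ.erase i, ((m j).factorial : ℝ) := by
        refine Finset.prod_congr rfl fun j hj => ?_
        simp [(Finset.ne_of_mem_erase hj).symm]
      rw [this]
      simp [Nat.factorial_succ]
      ring
    rw [hf]; ring

theorem pderiv_pderiv_comm {σ : Type*} (i j : σ) (p : MvPolynomial σ ℝ) :
    pderiv i (pderiv j p) = pderiv j (pderiv i p) := by
  classical
  ext m
  simp only [coeff_pderiv]
  rw [add_right_comm m]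
  by_cases h : i = j
  · subst h; rfl
  · simp [h, Ne.symm h]
    ring

/-- The linear form `∑ y_i X_i`. -/
noncomputable def linForm (y : σ → ℝ) : MvPolynomial σ ℝ := ∑ i, C (y i) * X i

/-- The quadratic form `∑ X_i²`. -/
noncomputable def normSqForm (σ : Type*) [Fintype σ] : MvPolynomial σ ℝ := ∑ i, X i * X i

/-- The derivative in direction `y`. -/
noncomputable def dirDeriv (y : σ → ℝ) :
    Derivation ℝ (MvPolynomial σ ℝ) (MvPolynomial σ ℝ) := ∑ i, y i • pderiv i

/-- The Laplacian on polynomials. -/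
noncomputable def lapl : MvPolynomial σ ℝ →ₗ[ℝ] MvPolynomial σ ℝ :=
  ∑ i, (pderiv i).toLinearMap ∘ₗ (pderiv i).toLinearMap

theorem dirDeriv_apply (y : σ → ℝ) (p : MvPolynomial σ ℝ) :
    dirDeriv y p = ∑ i, y i • pderiv i p := by
  have h : ∀ s : Finset σ, (∑ i ∈ s, y i • pderiv (R := ℝ) i) p = ∑ i ∈ s, y i • pderiv i p := by
    intro s
    classical
    induction s using Finset.induction_on with
    | empty => simp
    | insert i s hi ih => rw [Finset.sum_insert hi, Finset.sum_insert hi, ← ih]; simp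
  exact h _

theorem lapl_apply (p : MvPolynomial σ ℝ) : lapl p = ∑ i, pderiv i (pderiv i p) := by
  simp [lapl]

theorem pderiv_linForm (y : σ → ℝ) (i : σ) : pderiv i (linForm y) = C (y i) := by
  classical
  simp [linForm, Pi.single_apply]

theorem pderiv_normSqForm (i : σ) : pderiv i (normSqForm σ) = 2 * X i := by
  classical
  simp [normSqForm, Pi.single_apply, Finset.sum_add_distrib]
  ring

theorem dirDeriv_linForm (y : σ → ℝ) : dirDeriv y (linForm y) = C (∑ i, y i ^ 2) := by
  simp [dirDeriv_apply, pderiv_linForm, smul_eq_C_mul, sq]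

theorem dirDeriv_normSqForm (y : σ → ℝ) : dirDeriv y (normSqForm σ) = 2 * linForm y := by
  simp only [dirDeriv_apply, pderiv_normSqForm, smul_eq_C_mul, linForm, Finset.mul_sum]
  exact Finset.sum_congr rfl fun _ _ => by ring

theorem lapl_linForm_mul (y : σ → ℝ) (p : MvPolynomial σ ℝ) :
    lapl (linForm y * p) = 2 * dirDeriv y p + linForm y * lapl p := by
  simp only [lapl_apply, dirDeriv_apply, Finset.mul_sum, ← Finset.sum_add_distrib]
  refine Finset.sum_congr rfl fun i _ => ?_
  simp only [pderiv_mul, pderiv_linForm, map_add, pderiv_C, smul_eq_C_mul]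
  ring

theorem lapl_normSqForm_mul {k : ℕ} {p : MvPolynomial σ ℝ} (hp : p.IsHomogeneous k) :
    lapl (normSqForm σ * p) =
      (2 * (Fintype.card σ : MvPolynomial σ ℝ) + 4 * (k : MvPolynomial σ ℝ)) * p +
        normSqForm σ * lapl p := by
  have he := hp.sum_X_mul_pderiv
  rw [nsmul_eq_mul] at he
  have h : lapl (normSqForm σ * p) =
      ∑ i : σ, (2 * p + 4 * (X i * pderiv i p) + normSqForm σ * pderiv i (pderiv i p)) := by
    rw [lapl_apply]
    refine Finset.sum_congr rfl fun i _ => ?_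
    have h2 : pderiv i (2 : MvPolynomial σ ℝ) = 0 := by
      have := pderiv_C (R := ℝ) (a := 2) (i := i)
      rwa [map_ofNat] at this
    simp only [pderiv_mul, pderiv_normSqForm, map_add, pderiv_X_self, h2]
    ring
  rw [h, Finset.sum_add_distrib, Finset.sum_add_distrib, ← Finset.mul_sum, ← Finset.mul_sum, he,
    ← Finset.mul_sum, ← lapl_apply, Finset.sum_const, Finset.card_univ, nsmul_eq_mul]
  ring

theorem lapl_dirDeriv (y : σ → ℝ) (p : MvPolynomial σ ℝ) :
    lapl (dirDeriv y p) = dirDeriv y (lapl p) := by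
  simp only [lapl_apply, dirDeriv_apply, map_sum, Derivation.map_smul]
  rw [Finset.sum_comm]
  refine Finset.sum_congr rfl fun i _ => Finset.sum_congr rfl fun j _ => ?_
  rw [pderiv_pderiv_comm i j p, pderiv_pderiv_comm i j]

theorem fischer_linForm_mul (y : σ → ℝ) (p q : MvPolynomial σ ℝ) :
    fischer (linForm y * p) q = fischer p (dirDeriv y q) := by
  simp only [linForm, dirDeriv_apply, Finset.sum_mul, map_sum, map_smul, ← smul_eq_C_mul,
    smul_mul_assoc, LinearMap.sum_apply, LinearMap.smul_apply, fischer_X_mul]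

theorem fischer_normSqForm_mul (p q : MvPolynomial σ ℝ) :
    fischer (normSqForm σ * p) q = fischer p (lapl q) := by
  simp only [normSqForm, lapl_apply, Finset.sum_mul, map_sum, mul_assoc,
    LinearMap.sum_apply, fischer_X_mul]

theorem isHomogeneous_linForm (y : σ → ℝ) : (linForm y).IsHomogeneous 1 :=
  IsHomogeneous.sum _ _ _ fun _ _ => isHomogeneous_C_mul_X _ _

theorem isHomogeneous_normSqForm : (normSqForm σ).IsHomogeneous 2 :=
  IsHomogeneous.sum _ _ _ fun i _ => (isHomogeneous_X ℝ i).mul (isHomogeneous_X ℝ i)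

theorem isHomogeneous_dirDeriv (y : σ → ℝ) {k : ℕ} {p : MvPolynomial σ ℝ}
    (hp : p.IsHomogeneous (k + 1)) : (dirDeriv y p).IsHomogeneous k := by
  rw [dirDeriv_apply]
  refine IsHomogeneous.sum _ _ _ fun i _ => ?_
  rw [smul_eq_C_mul]
  exact (hp.pderiv (i := i)).C_mul _

theorem eval_dirDeriv_self (y : σ → ℝ) {k : ℕ} {p : MvPolynomial σ ℝ} (hp : p.IsHomogeneous k) :
    eval y (dirDeriv y p) = k * eval y p := by
  have he := congrArg (eval y) hp.sum_X_mul_pderiv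
  simp only [map_sum, map_mul, eval_X, nsmul_eq_mul, map_natCast] at he
  simp only [dirDeriv_apply, map_sum, smul_eq_C_mul, map_mul, eval_C, he]

/-- The zonal harmonic polynomial with pole `y`, homogenizing `gegenbauerPoly lam k`. -/
noncomputable def zonal (lam : ℝ) (y : σ → ℝ) : ℕ → MvPolynomial σ ℝ
  | 0 => 1
  | 1 => C (2 * lam) * linForm y
  | k + 2 =>
      C (1 / ((k : ℝ) + 2)) *
        (C (2 * ((k : ℝ) + 1 + lam)) * (linForm y * zonal lam y (k + 1)) -
          C ((k : ℝ) + 2 * lam) * (normSqForm σ * zonal lam y k))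

theorem zonal_rec (lam : ℝ) (y : σ → ℝ) (k : ℕ) :
    C ((k : ℝ) + 2) * zonal lam y (k + 2) =
      C (2 * ((k : ℝ) + 1 + lam)) * (linForm y * zonal lam y (k + 1)) -
          C ((k : ℝ) + 2 * lam) * (normSqForm σ * zonal lam y k) := by
  rw [zonal, ← mul_assoc, ← C_mul, mul_one_div_cancel (by positivity), C_1, one_mul]

theorem zonal_zero (lam : ℝ) (y : σ → ℝ) : zonal lam y 0 = 1 := by rw [zonal]

theorem zonal_one (lam : ℝ) (y : σ → ℝ) : zonal lam y 1 = C (2 * lam) * linForm y := by rw [zonal]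

theorem isHomogeneous_zonal (lam : ℝ) (y : σ → ℝ) (k : ℕ) :
    (zonal lam y k).IsHomogeneous k := by
  induction k using Nat.twoStepInduction with
  | zero => rw [zonal_zero]; exact isHomogeneous_one _ _
  | one => rw [zonal_one]; exact (isHomogeneous_linForm y).C_mul _
  | more k h0 h1 =>
    rw [zonal]
    refine IsHomogeneous.C_mul (IsHomogeneous.sub (IsHomogeneous.C_mul ?_ _)
      (IsHomogeneous.C_mul ?_ _)) _
    · have := (isHomogeneous_linForm y).mul h1
      rwa [show 1 + (k + 1) = k + 2 by ring] at this
    · have := (isHomogeneous_normSqForm (σ := σ)).mul h0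
      rwa [show 2 + k = k + 2 by ring] at this

theorem eval_zonal (lam : ℝ) (y : σ → ℝ) {w : σ → ℝ} (hw : ∑ i, w i ^ 2 = 1) (k : ℕ) :
    eval w (zonal lam y k) = (gegenbauerPoly lam k).eval (∑ i, y i * w i) := by
  induction k using Nat.twoStepInduction with
  | zero => simp [zonal_zero]
  | one => simp [zonal_one, gegenbauerPoly, linForm]
  | more k h0 h1 =>
    have hk : ((k : ℝ) + 2) ≠ 0 := by positivity
    apply mul_left_cancel₀ hk
    rw [gegenbauerPoly_eval_rec, ← h0, ← h1]
    have h := congrArg (eval w) (zonal_rec lam y k)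
    have hn : eval w (normSqForm σ) = 1 := by
      rw [← hw]; simp [normSqForm, sq]
    have hl : eval w (linForm y) = ∑ i, y i * w i := by simp [linForm]
    simp only [map_mul, map_sub, eval_C, hn, hl] at h
    linear_combination h

/-- Differentiate the recurrence and insert the two preceding cases: what remains is again the
recurrence one degree lower, which is why the induction is strong. -/
theorem dirDeriv_zonal (lam : ℝ) {y : σ → ℝ} (hy : ∑ i, y i ^ 2 = 1) (k : ℕ) :
    dirDeriv y (zonal lam y (k + 1)) = C ((k : ℝ) + 2 * lam) * zonal lam y k := by
  have hC (a : ℝ) (p : MvPolynomial σ ℝ) : dirDeriv y (C a * p) = C a * dirDeriv y p := by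
    rw [← smul_eq_C_mul, Derivation.map_smul, smul_eq_C_mul]
  induction k using Nat.strong_induction_on with
  | _ k ih =>
  rcases k with _ | _ | k
  · rw [zonal_one, zonal_zero, hC, dirDeriv_linForm, hy]; simp
  · apply mul_left_cancel₀ (C_ne_zero.2 (by positivity : ((0 : ℕ) : ℝ) + 2 ≠ 0))
    rw [← hC, zonal_rec, map_sub, hC, hC, Derivation.leibniz, Derivation.leibniz,
      dirDeriv_linForm, hy, dirDeriv_normSqForm, ih 0 (by norm_num), zonal_zero, zonal_one, Derivation.map_one_eq_zero]
    simp only [smul_eq_mul, Nat.cast_zero, zero_add, map_add, map_mul, map_ofNat, map_one,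
      Nat.cast_one]
    ring
  · apply mul_left_cancel₀ (C_ne_zero.2 (by positivity : ((k + 1 : ℕ) : ℝ) + 2 ≠ 0))
    rw [← hC, zonal_rec, map_sub, hC, hC, Derivation.leibniz, Derivation.leibniz,
      dirDeriv_linForm, hy, dirDeriv_normSqForm, ih (k + 1) (by omega), ih k (by omega)]
    have h := zonal_rec lam y k
    simp only [smul_eq_mul]
    push_cast
    simp only [map_add, map_mul, map_natCast, map_ofNat, map_one] at h ⊢
    linear_combination (-(k : MvPolynomial σ ℝ) - 1 - 2 * C lam) * h

/-- In the recurrence, the linear form contributes `4(k + 1 + lam)(k + 2 lam)` times the zonal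
polynomial of degree `k`, and the norm form `(k + 2 lam)(2n + 4k)` times it, where `n` is the number
of variables. These cancel precisely because `n = 2 lam + 2`. -/
theorem lapl_zonal {lam : ℝ} (hl : (Fintype.card σ : ℝ) = 2 * lam + 2) {y : σ → ℝ}
    (hy : ∑ i, y i ^ 2 = 1) (k : ℕ) : lapl (zonal lam y k) = 0 := by
  have hC (a : ℝ) (p : MvPolynomial σ ℝ) : lapl (C a * p) = C a * lapl p := by
    rw [← smul_eq_C_mul, map_smul, smul_eq_C_mul]
  have hcard : (Fintype.card σ : MvPolynomial σ ℝ) = 2 * C lam + 2 := by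
    have := congrArg (C (σ := σ)) hl
    simpa only [map_add, map_mul, map_natCast, map_ofNat] using this
  have h1 : lapl (1 : MvPolynomial σ ℝ) = 0 := by simp [lapl_apply]
  induction k using Nat.twoStepInduction with
  | zero => rw [zonal_zero, h1]
  | one =>
    rw [zonal_one, hC, ← mul_one (linForm y), lapl_linForm_mul, h1]; simp
  | more k h0 h1 =>
    apply mul_left_cancel₀ (C_ne_zero.2 (by positivity : (k : ℝ) + 2 ≠ 0))
    rw [← hC, zonal_rec, map_sub, hC, hC, lapl_linForm_mul,
      lapl_normSqForm_mul (isHomogeneous_zonal lam y k), h0, h1, dirDeriv_zonal lam hy, hcard]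
    simp only [map_add, map_mul, map_natCast, map_ofNat, map_one]
    ring

/-- Zonal harmonics reproduce the values of harmonic polynomials up to a positive factor. -/
theorem exists_fischer_zonal {lam : ℝ} (hl : 0 < lam) (k : ℕ) :
    ∃ b : ℝ, 0 < b ∧ ∀ (y : σ → ℝ) (q : MvPolynomial σ ℝ), q.IsHomogeneous k → lapl q = 0 →
      fischer (zonal lam y k) q = b * eval y q := by
  induction k with
  | zero =>
    refine ⟨1, one_pos, fun y q hq _ => ?_⟩
    have hq' : q = C (coeff 0 q) :=
      totalDegree_eq_zero_iff_eq_C.1 ((totalDegree_zero_iff_isHomogeneous σ).2 hq)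
    have h1 : (1 : MvPolynomial σ ℝ) = monomial 0 1 := rfl
    rw [zonal_zero, h1, fischer_monomial]
    conv_rhs => rw [hq']
    simp
  | succ k ih =>
    obtain ⟨b, hb, ih⟩ := ih
    refine ⟨2 * (k + lam) * b, by positivity, fun y q hq hΔ => ?_⟩
    have hd := ih y (dirDeriv y q) (isHomogeneous_dirDeriv y hq) (by rw [lapl_dirDeriv, hΔ, map_zero])
    rw [eval_dirDeriv_self y hq] at hd
    rcases k with _ | k
    · rw [zonal_one, ← mul_one (linForm y), ← smul_eq_C_mul, map_smul, LinearMap.smul_apply,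
        fischer_linForm_mul, ← zonal_zero lam y, hd]
      simp; ring
    -- By adjointness the norm form turns into the Laplacian, which kills `q`, and the linear form
    -- turns into `dirDeriv y q`, still harmonic. Its value at `y` is the degree times `q(y)` by
    -- Euler's identity; the degree cancels `k + 2`.
    · have hk : ((k : ℝ) + 2) ≠ 0 := by positivity
      apply mul_left_cancel₀ hk
      have h := congrArg (fun p => fischer p q) (zonal_rec lam y k)
      simp only [← smul_eq_C_mul, map_sub, map_smul, LinearMap.sub_apply, LinearMap.smul_apply,
        fischer_linForm_mul, fischer_normSqForm_mul, hΔ, map_zero, smul_eq_mul, mul_zero,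
        sub_zero] at h
      rw [h, hd]
      push_cast
      ring

end MvPolynomial

/-- Gegenbauer polynomials are isotropic parts of positive definite kernels on spheres. -/
theorem gegenbauerPoly_quadForm_nonneg {σ ι : Type*} [Fintype σ] [Fintype ι] {lam : ℝ}
    (hl : 0 < lam) (hcard : (Fintype.card σ : ℝ) = 2 * lam + 2) (k : ℕ) (x : ι → σ → ℝ)
    (hx : ∀ i, ∑ s, x i s ^ 2 = 1) (c : ι → ℝ) :
    0 ≤ ∑ i, ∑ j, c i * c j * (gegenbauerPoly lam k).eval (∑ s, x i s * x j s) := by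
  obtain ⟨b, hb, h⟩ := MvPolynomial.exists_fischer_zonal (σ := σ) hl k
  -- By the reproducing property, the Fischer norm of this combination of zonal harmonics is `b`
  -- times the quadratic form.
  set P : MvPolynomial σ ℝ := ∑ i, c i • MvPolynomial.zonal lam (x i) k with hP
  have hPP : MvPolynomial.fischer P P =
      b * ∑ i, ∑ j, c i * c j * (gegenbauerPoly lam k).eval (∑ s, x i s * x j s) := by
    simp only [hP, map_sum, map_smul, LinearMap.sum_apply, LinearMap.smul_apply, Finset.mul_sum,
      smul_eq_mul]
    rw [Finset.sum_comm]
    refine Finset.sum_congr rfl fun i _ => Finset.sum_congr rfl fun j _ => ?_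
    rw [h _ _ (MvPolynomial.isHomogeneous_zonal lam _ k) (MvPolynomial.lapl_zonal hcard (hx _) k),
      MvPolynomial.eval_zonal lam _ (hx _)]
    simp only [mul_comm (x i _)]
    ring
  have h0 := MvPolynomial.fischer_self_nonneg P
  rw [hPP] at h0
  exact nonneg_of_mul_nonneg_right h0 hb

/-! ### Positive definite isotropic kernels -/

section Kernel

variable {d : ℕ}

/-- The inner product of two points of the sphere. -/
noncomputable def sphereInner (x y : UnitSphere d) : ℝ :=
  inner ℝ (x : EuclideanSpace ℝ (Fin (d + 1))) (y : EuclideanSpace ℝ (Fin (d + 1)))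

theorem isotropicKernel_eq_sphereInner (f : ℝ → ℝ) (x y : UnitSphere d) :
    isotropicKernel d f x y = f (sphereInner x y) := isotropicKernel_eq_inner d f x y

theorem norm_unitSphere (x : UnitSphere d) : ‖(x : EuclideanSpace ℝ (Fin (d + 1)))‖ = 1 :=
  norm_eq_of_mem_sphere x

theorem sphereInner_comm (x y : UnitSphere d) : sphereInner x y = sphereInner y x :=
  real_inner_comm _ _

theorem sphereInner_self (x : UnitSphere d) : sphereInner x x = 1 := by
  rw [sphereInner, real_inner_self_eq_norm_sq, norm_unitSphere, one_pow]

theorem sphereInner_mem (x y : UnitSphere d) : sphereInner x y ∈ Set.Icc (-1 : ℝ) 1 := by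
  have h := abs_real_inner_le_norm (x : EuclideanSpace ℝ (Fin (d + 1))) y
  rw [norm_unitSphere, norm_unitSphere, mul_one] at h
  exact abs_le.1 h

theorem sphereInner_eq_one_iff {x y : UnitSphere d} : sphereInner x y = 1 ↔ x = y := by
  rw [sphereInner, inner_eq_one_iff_of_norm_eq_one (norm_unitSphere x) (norm_unitSphere y),
    Subtype.ext_iff]

theorem sphereInner_eq_sum (x y : UnitSphere d) :
    sphereInner x y = ∑ s, (x : EuclideanSpace ℝ (Fin (d + 1))) s *
      (y : EuclideanSpace ℝ (Fin (d + 1))) s := by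
  simp [sphereInner, PiLp.inner_apply, mul_comm]

/-- The matrix of the isotropic kernel of `f` at a family of points. -/
noncomputable def sphereMatrix {ι : Type*} (f : ℝ → ℝ) (x : ι → UnitSphere d) : Matrix ι ι ℝ :=
  Matrix.of fun i j => f (sphereInner (x i) (x j))

theorem sphereMatrix_isHermitian {ι : Type*} (f : ℝ → ℝ) (x : ι → UnitSphere d) :
    (sphereMatrix f x).IsHermitian := by
  ext i j
  simp [sphereMatrix, sphereInner_comm (x j)]

/-- The quadratic form of the isotropic kernel of `f`. -/
noncomputable def sphereForm {ι : Type*} [Fintype ι] (f : ℝ → ℝ) (x : ι → UnitSphere d)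
    (c : ι → ℝ) : ℝ :=
  ∑ i, ∑ j, c i * c j * f (sphereInner (x i) (x j))

theorem sphereForm_eq {ι : Type*} [Fintype ι] (f : ℝ → ℝ) (x : ι → UnitSphere d) (c : ι → ℝ) :
    sphereForm f x c = c ⬝ᵥ (sphereMatrix f x).mulVec c := by
  simp only [sphereForm, dotProduct, Matrix.mulVec, sphereMatrix, Matrix.of_apply, Finset.mul_sum]
  exact Finset.sum_congr rfl fun i _ => Finset.sum_congr rfl fun j _ => by ring

theorem sphereMatrix_posSemidef_iff {ι : Type*} [Fintype ι] (f : ℝ → ℝ) (x : ι → UnitSphere d) :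
    (sphereMatrix f x).PosSemidef ↔ ∀ c, 0 ≤ sphereForm f x c := by
  rw [Matrix.posSemidef_iff_dotProduct_mulVec, and_iff_right (sphereMatrix_isHermitian f x)]
  simp [sphereForm_eq]

theorem sphereForm_reindex {ι κ : Type*} [Fintype ι] [Fintype κ] (e : κ ≃ ι) (f : ℝ → ℝ)
    (x : ι → UnitSphere d) (c : ι → ℝ) :
    sphereForm f (x ∘ e) (c ∘ e) = sphereForm f x c := by
  simp only [sphereForm, Function.comp_apply]
  rw [← e.sum_comp]
  exact Finset.sum_congr rfl fun i _ =>
    e.sum_comp fun j => c (e i) * c j * f (sphereInner (x (e i)) (x j))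

/-- The definition only tests distinct points. A family with repetitions has a matrix pulled back
from that of its range, and positive semidefiniteness survives the pullback. -/
theorem IsIsotropicPartPD.sphereForm_nonneg {f : ℝ → ℝ} (hf : IsIsotropicPartPD d f) {ι : Type*}
    [Fintype ι] (x : ι → UnitSphere d) (c : ι → ℝ) : 0 ≤ sphereForm f x c := by
  classical
  have hinj : ∀ {κ : Type _} [Fintype κ] (z : κ → UnitSphere d), Function.Injective z →
      ∀ b, 0 ≤ sphereForm f z b := by
    intro κ _ z hz b
    rw [← sphereForm_reindex (Fintype.equivFin κ).symm]
    have := hf.2 _ (z ∘ (Fintype.equivFin κ).symm) (hz.comp (Equiv.injective _))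
      (b ∘ (Fintype.equivFin κ).symm)
    simpa only [isotropicKernel_eq_sphereInner, sphereForm] using this
  have h := (sphereMatrix_posSemidef_iff f (Subtype.val : Set.range x → UnitSphere d)).2
    (hinj _ Subtype.val_injective)
  have h' : sphereMatrix f x = (sphereMatrix f (Subtype.val : Set.range x → UnitSphere d)).submatrix
    (Set.rangeFactorization x) (Set.rangeFactorization x) := by
    ext i j; rfl
  have h2 := h.submatrix (Set.rangeFactorization x)
  rw [← h'] at h2
  exact (sphereMatrix_posSemidef_iff f x).1 h2 c

theorem IsIsotropicPartPD.posSemidef {f : ℝ → ℝ} (hf : IsIsotropicPartPD d f) {ι : Type*}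
    [Fintype ι] (x : ι → UnitSphere d) : (sphereMatrix f x).PosSemidef :=
  (sphereMatrix_posSemidef_iff f x).2 (hf.sphereForm_nonneg x)

theorem isIsotropicPartPD_of_sphereForm {f : ℝ → ℝ} (hc : ContinuousOn f (Set.Icc (-1) 1))
    (h : ∀ (n : ℕ) (x : Fin n → UnitSphere d) c, 0 ≤ sphereForm f x c) :
    IsIsotropicPartPD d f := by
  refine ⟨hc, fun n x _ c => ?_⟩
  simpa only [isotropicKernel_eq_sphereInner, sphereForm] using h n x c

theorem IsIsotropicPartPD.mul {f g : ℝ → ℝ} (hf : IsIsotropicPartPD d f)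
    (hg : IsIsotropicPartPD d g) : IsIsotropicPartPD d fun t => f t * g t := by
  refine isIsotropicPartPD_of_sphereForm (hf.1.mul hg.1) fun n x => ?_
  exact (sphereMatrix_posSemidef_iff _ x).1 ((hf.posSemidef x).hadamard (hg.posSemidef x))

theorem isIsotropicPartPD_one : IsIsotropicPartPD d fun _ => 1 := by
  refine isIsotropicPartPD_of_sphereForm continuousOn_const fun n x c => ?_
  have : sphereForm (fun _ => 1) x c = (∑ i, c i) * ∑ j, c j := by
    simp [sphereForm, Finset.sum_mul_sum]
  rw [this]; exact mul_self_nonneg _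

theorem IsIsotropicPartPD.pow {f : ℝ → ℝ} (hf : IsIsotropicPartPD d f) (n : ℕ) :
    IsIsotropicPartPD d fun t => f t ^ n := by
  induction n with
  | zero => simpa using isIsotropicPartPD_one
  | succ n ih => simpa only [pow_succ] using ih.mul hf

theorem isIsotropicPartPD_gegenbauerPoly (hd : 2 ≤ d) (k : ℕ) :
    IsIsotropicPartPD d fun t => (gegenbauerPoly (((d : ℝ) - 1) / 2) k).eval t := by
  refine isIsotropicPartPD_of_sphereForm (Polynomial.continuousOn _) fun n x c => ?_
  have hd' : (2 : ℝ) ≤ d := by exact_mod_cast hd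
  have h := gegenbauerPoly_quadForm_nonneg (σ := Fin (d + 1)) (lam := ((d : ℝ) - 1) / 2)
    (by linarith) (by simp; ring) k (fun i s => (x i : EuclideanSpace ℝ (Fin (d + 1))) s)
    (fun i => by
      have := norm_unitSphere (x i)
      rw [EuclideanSpace.norm_eq, Real.sqrt_eq_one] at this
      simpa using this) c
  simpa only [sphereForm, sphereInner_eq_sum] using h

/-- The form is half the sum of two Gram forms. Powers of this function are positive definite and
peak at `t = 1`, so they serve as an approximate identity. -/
theorem isIsotropicPartPD_half_one_add : IsIsotropicPartPD d fun t => (1 + t) / 2 := by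
  refine isIsotropicPartPD_of_sphereForm (by fun_prop) fun n x c => ?_
  have h : sphereForm (fun t => (1 + t) / 2) x c = ((∑ i, c i) * (∑ j, c j) +
      inner ℝ (∑ i, c i • (x i : EuclideanSpace ℝ (Fin (d + 1))))
        (∑ i, c i • (x i : EuclideanSpace ℝ (Fin (d + 1))))) / 2 := by
    simp only [sphereForm, sum_inner, inner_sum, Finset.sum_mul_sum, real_inner_smul_left,
      real_inner_smul_right, ← Finset.sum_add_distrib, Finset.sum_div, sphereInner]
    refine Finset.sum_congr rfl fun i _ => Finset.sum_congr rfl fun j _ => ?_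
    rw [real_inner_comm]
    ring
  rw [h]
  have := real_inner_self_nonneg (x := ∑ i, c i • (x i : EuclideanSpace ℝ (Fin (d + 1))))
  have := mul_self_nonneg (∑ i, c i)
  positivity

end Kernel

/-! ### Zonal means over the sphere -/

section SphereMean

open MeasureTheory
open scoped Pointwise

variable {d : ℕ}

/-- The surface measure on the unit sphere. -/
noncomputable def sphereMeasure (d : ℕ) : Measure (UnitSphere d) :=
  (volume : Measure (EuclideanSpace ℝ (Fin (d + 1)))).toSphere

instance : IsFiniteMeasure (sphereMeasure d) := by
  unfold sphereMeasure; infer_instance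

instance : (sphereMeasure d).IsOpenPosMeasure := by
  unfold sphereMeasure; infer_instance

theorem sphereMeasure_ne_zero (d : ℕ) : sphereMeasure d ≠ 0 := by
  unfold sphereMeasure; exact Measure.toSphere_ne_zero _

theorem integrable_sphereMeasure {F : UnitSphere d → ℝ} (hF : Continuous F) :
    Integrable F (sphereMeasure d) :=
  hF.integrable_of_hasCompactSupport (HasCompactSupport.of_compactSpace F)

/-- The action of a linear isometry on the sphere. -/
noncomputable def sphereMap (L : EuclideanSpace ℝ (Fin (d + 1)) ≃ₗᵢ[ℝ] EuclideanSpace ℝ (Fin (d + 1)))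
    (x : UnitSphere d) : UnitSphere d :=
  ⟨L x, by simp⟩

theorem continuous_sphereMap
    (L : EuclideanSpace ℝ (Fin (d + 1)) ≃ₗᵢ[ℝ] EuclideanSpace ℝ (Fin (d + 1))) :
    Continuous (sphereMap L) :=
  (L.continuous.comp continuous_subtype_val).subtype_mk _

/-- The surface measure of a set is defined through the volume of the cone over it; a linear
isometry commutes with forming cones and preserves volume. -/
theorem measurePreserving_sphereMap
    (L : EuclideanSpace ℝ (Fin (d + 1)) ≃ₗᵢ[ℝ] EuclideanSpace ℝ (Fin (d + 1))) :
    MeasurePreserving (sphereMap L) (sphereMeasure d) (sphereMeasure d) := by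
  have hm := (continuous_sphereMap L).measurable
  refine ⟨hm, ?_⟩
  ext s hs
  rw [Measure.map_apply hm hs, sphereMeasure, Measure.toSphere_apply' _ (hm hs),
    Measure.toSphere_apply' _ hs]
  congr 1
  have hset : Set.Ioo (0 : ℝ) 1 • ((↑) '' (sphereMap L ⁻¹' s) : Set (EuclideanSpace ℝ (Fin (d + 1)))) =
      L ⁻¹' (Set.Ioo (0 : ℝ) 1 • ((↑) '' s : Set (EuclideanSpace ℝ (Fin (d + 1))))) := by
    ext v
    simp only [Set.mem_smul, Set.mem_preimage, Set.mem_image]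
    constructor
    · rintro ⟨r, hr, _, ⟨x, hx, rfl⟩, rfl⟩
      exact ⟨r, hr, _, ⟨_, hx, rfl⟩, by simp [sphereMap]⟩
    · rintro ⟨r, hr, _, ⟨x, hx, rfl⟩, h⟩
      refine ⟨r, hr, _, ⟨sphereMap L.symm x, ?_, rfl⟩, ?_⟩
      · have : sphereMap L (sphereMap L.symm x) = x := by
          ext1; simp [sphereMap]
        rwa [this]
      · apply L.injective
        rw [← h]; simp [sphereMap]
  rw [hset]
  exact L.measurePreserving.measure_preimage_emb L.toHomeomorph.measurableEmbedding _

theorem integral_comp_sphereMap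
    (L : EuclideanSpace ℝ (Fin (d + 1)) ≃ₗᵢ[ℝ] EuclideanSpace ℝ (Fin (d + 1)))
    {F : UnitSphere d → ℝ} (hF : Continuous F) :
    ∫ x, F (sphereMap L x) ∂sphereMeasure d = ∫ x, F x ∂sphereMeasure d := by
  have h := measurePreserving_sphereMap L
  conv_rhs => rw [← h.map_eq]
  rw [integral_map h.measurable.aemeasurable hF.aestronglyMeasurable]

theorem continuous_sphereInner_left (e : UnitSphere d) : Continuous fun x => sphereInner x e := by
  unfold sphereInner; fun_prop

theorem continuous_comp_sphereInner {h : ℝ → ℝ} (hc : ContinuousOn h (Set.Icc (-1) 1))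
    (e : UnitSphere d) : Continuous fun x => h (sphereInner x e) :=
  hc.comp_continuous (continuous_sphereInner_left e) fun x => sphereInner_mem x e

/-- The first basis vector as a point of the sphere. -/
noncomputable def pole (d : ℕ) : UnitSphere d :=
  ⟨EuclideanSpace.single 0 1, by simp⟩

/-- The integral of a zonal function over the sphere. -/
noncomputable def sphereMean (d : ℕ) (h : ℝ → ℝ) : ℝ :=
  ∫ x, h (sphereInner x (pole d)) ∂sphereMeasure d

theorem integral_zonal {h : ℝ → ℝ} (hc : ContinuousOn h (Set.Icc (-1) 1)) (e : UnitSphere d) :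
    ∫ x, h (sphereInner x e) ∂sphereMeasure d = sphereMean d h := by
  -- Reflection in the hyperplane orthogonal to `e - pole` carries `e` to the pole.
  set v : EuclideanSpace ℝ (Fin (d + 1)) := (e : EuclideanSpace ℝ (Fin (d + 1))) - pole d
  set L := (ℝ ∙ v)ᗮ.reflection with hL
  have hLe : L e = pole d := Submodule.reflection_sub (by rw [norm_unitSphere, norm_unitSphere])
  rw [sphereMean, ← integral_comp_sphereMap L (continuous_comp_sphereInner hc (pole d))]
  congr 1
  ext x
  congr 1
  simp only [sphereInner, sphereMap]
  rw [← hLe, LinearIsometryEquiv.inner_map_map]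

/-- The points of a great circle through the pole. -/
noncomputable def circlePoint (hd : 1 ≤ d) (u v : ℝ) (huv : u ^ 2 + v ^ 2 = 1) : UnitSphere d :=
  ⟨EuclideanSpace.single 0 u + EuclideanSpace.single (Fin.last d) v, by
    have h : Fin.last d ≠ 0 := by simp [Fin.ext_iff]; omega
    rw [mem_sphere_zero_iff_norm, ← sq_eq_sq₀ (norm_nonneg _) zero_le_one,
      ← real_inner_self_eq_norm_sq, inner_add_left, inner_add_right, inner_add_right]
    simp only [EuclideanSpace.inner_single_left, PiLp.single_apply, h, h.symm]
    simp
    linarith⟩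

theorem sphereInner_circlePoint (hd : 1 ≤ d) {u v u' v' : ℝ} (h : u ^ 2 + v ^ 2 = 1)
    (h' : u' ^ 2 + v' ^ 2 = 1) :
    sphereInner (circlePoint hd u v h) (circlePoint hd u' v' h') = u * u' + v * v' := by
  have h : Fin.last d ≠ 0 := by simp [Fin.ext_iff]; omega
  simp only [sphereInner, circlePoint, inner_add_left, inner_add_right,
    EuclideanSpace.inner_single_left, PiLp.single_apply, h, h.symm]
  simp

theorem exists_sphereInner_pole_eq (hd : 1 ≤ d) {t : ℝ} (ht : t ∈ Set.Icc (-1 : ℝ) 1) :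
    ∃ x : UnitSphere d, sphereInner x (pole d) = t := by
  have h2 : 0 ≤ 1 - t ^ 2 := by nlinarith [ht.1, ht.2]
  have hp : pole d = circlePoint hd 1 0 (by norm_num) := by
    ext1; simp [pole, circlePoint]
  refine ⟨circlePoint hd t √(1 - t ^ 2) (by rw [Real.sq_sqrt h2]; ring), ?_⟩
  rw [hp, sphereInner_circlePoint]
  ring

theorem sphereMean_add {g h : ℝ → ℝ} (hg : ContinuousOn g (Set.Icc (-1) 1))
    (hh : ContinuousOn h (Set.Icc (-1) 1)) :
    sphereMean d (fun t => g t + h t) = sphereMean d g + sphereMean d h :=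
  integral_add (integrable_sphereMeasure (continuous_comp_sphereInner hg _))
    (integrable_sphereMeasure (continuous_comp_sphereInner hh _))

theorem sphereMean_const_mul (a : ℝ) (h : ℝ → ℝ) :
    sphereMean d (fun t => a * h t) = a * sphereMean d h :=
  integral_const_mul _ _

theorem sphereMean_mono {g h : ℝ → ℝ} (hg : ContinuousOn g (Set.Icc (-1) 1))
    (hh : ContinuousOn h (Set.Icc (-1) 1)) (hle : ∀ t ∈ Set.Icc (-1 : ℝ) 1, g t ≤ h t) :
    sphereMean d g ≤ sphereMean d h :=
  integral_mono (integrable_sphereMeasure (continuous_comp_sphereInner hg _))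
    (integrable_sphereMeasure (continuous_comp_sphereInner hh _)) fun _ => hle _ (sphereInner_mem _ _)

theorem sphereMean_pos (hd : 1 ≤ d) {h : ℝ → ℝ} (hc : ContinuousOn h (Set.Icc (-1) 1))
    (h0 : ∀ t ∈ Set.Icc (-1 : ℝ) 1, 0 ≤ h t) {t : ℝ} (ht : t ∈ Set.Icc (-1 : ℝ) 1)
    (hpos : h t ≠ 0) : 0 < sphereMean d h := by
  obtain ⟨x, hx⟩ := exists_sphereInner_pole_eq hd ht
  refine (continuous_comp_sphereInner hc _).integral_pos_of_hasCompactSupport_nonneg_nonzero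
    (HasCompactSupport.of_compactSpace _) (fun y => h0 _ (sphereInner_mem _ _)) (x := x) ?_
  rwa [hx]

/-- The mean of a positive definite zonal function is nonnegative: choosing points one by one with
at most average interaction makes the quadratic form too small otherwise. -/
theorem IsIsotropicPartPD.sphereMean_nonneg {f : ℝ → ℝ} (hf : IsIsotropicPartPD d f) :
    0 ≤ sphereMean d f := by
  have hm : 0 < (sphereMeasure d).real Set.univ := by
    exact ENNReal.toReal_pos (by simpa using sphereMeasure_ne_zero d) (measure_ne_top _ _)
  set a : ℝ := ((sphereMeasure d).real Set.univ)⁻¹ * sphereMean d f with ha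
  have key : ∀ n : ℕ, ∃ x : Fin n → UnitSphere d,
      sphereForm f x (fun _ => 1) ≤ n * f 1 + n * (n - 1) * a := by
    intro n
    induction n with
    | zero => exact ⟨Fin.elim0, by simp [sphereForm]⟩
    | succ n ih =>
      obtain ⟨x, hx⟩ := ih
      have hint : ∀ i, Integrable (fun y => f (sphereInner y (x i))) (sphereMeasure d) := fun i =>
        integrable_sphereMeasure (continuous_comp_sphereInner hf.1 _)
      obtain ⟨y, hy⟩ := exists_le_average (sphereMeasure_ne_zero d)
        (integrable_finsetSum Finset.univ fun i _ => hint i)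
      have hav : ⨍ y, ∑ i, f (sphereInner y (x i)) ∂sphereMeasure d = n * a := by
        rw [average_eq, integral_finsetSum _ fun i _ => hint i]
        simp only [integral_zonal hf.1, smul_eq_mul, Finset.sum_const, Finset.card_univ,
          Fintype.card_fin, nsmul_eq_mul, ha]
        ring
      rw [hav] at hy
      refine ⟨Fin.cons y x, ?_⟩
      have hform : sphereForm f (Fin.cons y x : Fin (n + 1) → UnitSphere d) (fun _ => 1) =
          f 1 + 2 * ∑ i, f (sphereInner y (x i)) + sphereForm f x (fun _ => 1) := by
        simp only [sphereForm, Fin.sum_univ_succ, Fin.cons_zero, Fin.cons_succ, sphereInner_self,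
          Finset.sum_add_distrib, one_mul]
        simp only [sphereInner_comm _ y]
        ring
      rw [hform]
      push_cast
      linarith
  by_contra! hneg
  have ha0 : a < 0 := mul_neg_of_pos_of_neg (inv_pos.2 hm) hneg
  -- The choice makes `f 1 + n * a < a < 0`, so the bound `(n + 1)(f 1 + n * a)` for `n + 1` points
  -- is negative.
  obtain ⟨n, hn⟩ := exists_nat_gt ((f 1 - a) / (-a))
  rw [div_lt_iff₀ (by linarith)] at hn
  have hn0 : 0 < (n : ℝ) + 1 := by positivity
  obtain ⟨x, hx⟩ := key (n + 1)
  have h0 := hf.sphereForm_nonneg x (fun _ => 1)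
  push_cast at hx
  nlinarith

/-- Integration by parts on the sphere for one pair of coordinates. -/
theorem integral_pow_mul_sq (n : ℕ) (j : Fin (d + 1)) (hj : j ≠ 0) :
    n * ∫ x : UnitSphere d, (x : EuclideanSpace ℝ (Fin (d + 1))) 0 ^ (n - 1) *
        (x : EuclideanSpace ℝ (Fin (d + 1))) j ^ 2 ∂sphereMeasure d =
      ∫ x : UnitSphere d, (x : EuclideanSpace ℝ (Fin (d + 1))) 0 ^ (n + 1) ∂sphereMeasure d := by
  -- `F s x = ⟨x, w⟩^n ⟨x, v⟩` with `v` and `w` orthogonal, hence odd under the reflection along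
  -- `v`. Its integral vanishes for every `s`, and the derivative at `s = 0` is the claimed
  -- identity.
  set F : ℝ → UnitSphere d → ℝ := fun s x =>
    ((x : EuclideanSpace ℝ (Fin (d + 1))) 0 + s * (x : EuclideanSpace ℝ (Fin (d + 1))) j) ^ n *
      ((x : EuclideanSpace ℝ (Fin (d + 1))) j - s * (x : EuclideanSpace ℝ (Fin (d + 1))) 0) with hF
  set F' : ℝ → UnitSphere d → ℝ := fun s x =>
    n * ((x : EuclideanSpace ℝ (Fin (d + 1))) 0 +
        s * (x : EuclideanSpace ℝ (Fin (d + 1))) j) ^ (n - 1) *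
      (x : EuclideanSpace ℝ (Fin (d + 1))) j *
      ((x : EuclideanSpace ℝ (Fin (d + 1))) j - s * (x : EuclideanSpace ℝ (Fin (d + 1))) 0) -
    ((x : EuclideanSpace ℝ (Fin (d + 1))) 0 + s * (x : EuclideanSpace ℝ (Fin (d + 1))) j) ^ n *
      (x : EuclideanSpace ℝ (Fin (d + 1))) 0 with hF'
  have hco : ∀ i, Continuous fun x : UnitSphere d => (x : EuclideanSpace ℝ (Fin (d + 1))) i :=
    fun i => by fun_prop
  have hFc : ∀ s, Continuous (F s) := fun s =>
    (((hco 0).add (continuous_const.mul (hco j))).pow n).mul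
      ((hco j).sub (continuous_const.mul (hco 0)))
  have hF'c : Continuous (Function.uncurry F') := by
    have h0 : Continuous fun p : ℝ × UnitSphere d => (p.2 : EuclideanSpace ℝ (Fin (d + 1))) 0 :=
      (hco 0).comp continuous_snd
    have h1 : Continuous fun p : ℝ × UnitSphere d => (p.2 : EuclideanSpace ℝ (Fin (d + 1))) j :=
      (hco j).comp continuous_snd
    simp only [hF', Function.uncurry_def]
    fun_prop
  obtain ⟨B, hB⟩ := ((isCompact_Icc (a := (-1 : ℝ)) (b := 1)).prod
    (isCompact_univ (X := UnitSphere d))).exists_bound_of_continuousOn hF'c.continuousOn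
  have hder := hasDerivAt_integral_of_dominated_loc_of_deriv_le (μ := sphereMeasure d)
    (F := F) (F' := F') (x₀ := 0) (s := Set.Icc (-1) 1) (bound := fun _ => B)
    (Icc_mem_nhds (by norm_num) (by norm_num))
    (Eventually.of_forall fun s => (hFc s).aestronglyMeasurable)
    (integrable_sphereMeasure (hFc 0))
    (hF'c.comp (Continuous.prodMk_right 0)).aestronglyMeasurable
    (ae_of_all _ fun x s hs => hB (s, x) ⟨hs, Set.mem_univ _⟩)
    (integrable_const _)
    (ae_of_all _ fun x s _ => by
      have h1 := (((hasDerivAt_id s).mul_const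
        ((x : EuclideanSpace ℝ (Fin (d + 1))) j)).const_add
          ((x : EuclideanSpace ℝ (Fin (d + 1))) 0)).pow n
      have h2 := ((hasDerivAt_id s).mul_const
        ((x : EuclideanSpace ℝ (Fin (d + 1))) 0)).const_sub
          ((x : EuclideanSpace ℝ (Fin (d + 1))) j)
      refine (h1.mul h2).congr_deriv ?_
      simp only [hF', id, Pi.pow_apply]
      ring)
  have hzero : ∀ s, ∫ x, F s x ∂sphereMeasure d = 0 := by
    intro s
    set v : EuclideanSpace ℝ (Fin (d + 1)) :=
      EuclideanSpace.single j 1 - s • EuclideanSpace.single 0 1 with hv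
    set w : EuclideanSpace ℝ (Fin (d + 1)) :=
      EuclideanSpace.single 0 1 + s • EuclideanSpace.single j 1 with hw
    set L := (ℝ ∙ v)ᗮ.reflection with hL
    have hLv : L v = -v := Submodule.reflection_orthogonalComplement_singleton_eq_neg v
    have hLw : L w = w := by
      apply Submodule.reflection_mem_subspace_eq_self
      rw [Submodule.mem_orthogonal_singleton_iff_inner_right]
      simp [hv, hw, inner_sub_left, inner_add_right, real_inner_smul_left, real_inner_smul_right,
        EuclideanSpace.inner_single_left, hj, hj.symm]
    have hin : ∀ (x : UnitSphere d) (u : EuclideanSpace ℝ (Fin (d + 1))),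
        inner ℝ (L x) u = inner ℝ (x : EuclideanSpace ℝ (Fin (d + 1))) (L u) := by
      intro x u
      rw [← LinearIsometryEquiv.inner_map_map L (x : EuclideanSpace ℝ (Fin (d + 1))) (L u), hL,
        Submodule.reflection_reflection]
    have hFi : ∀ x : UnitSphere d, F s x = inner ℝ (x : EuclideanSpace ℝ (Fin (d + 1))) w ^ n *
        inner ℝ (x : EuclideanSpace ℝ (Fin (d + 1))) v := by
      intro x
      simp [hF, hv, hw, inner_sub_right, inner_add_right, real_inner_smul_right,
        EuclideanSpace.inner_single_right]
    have h := integral_comp_sphereMap L (hFc s)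
    have hanti : ∀ x, F s (sphereMap L x) = - F s x := by
      intro x
      rw [hFi, hFi]
      simp only [sphereMap]
      rw [hin, hin, hLv, hLw, inner_neg_right]
      ring
    simp only [hanti, integral_neg] at h
    linarith
  have hd0 : ∫ x, F' 0 x ∂sphereMeasure d = 0 := by
    have h := hder.2
    simp only [hzero] at h
    exact h.unique (hasDerivAt_const _ _)
  have hsplit : ∫ x, F' 0 x ∂sphereMeasure d =
      n * ∫ x : UnitSphere d, (x : EuclideanSpace ℝ (Fin (d + 1))) 0 ^ (n - 1) *
        (x : EuclideanSpace ℝ (Fin (d + 1))) j ^ 2 ∂sphereMeasure d -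
      ∫ x : UnitSphere d, (x : EuclideanSpace ℝ (Fin (d + 1))) 0 ^ (n + 1) ∂sphereMeasure d := by
    rw [← integral_const_mul, ← integral_sub]
    · congr 1
      ext x
      simp only [hF', zero_mul, add_zero, sub_zero]
      ring
    · exact integrable_sphereMeasure (continuous_const.mul (((hco 0).pow _).mul ((hco j).pow _)))
    · exact integrable_sphereMeasure ((hco 0).pow _)
  linarith

theorem sphereInner_pole (x : UnitSphere d) :
    sphereInner x (pole d) = (x : EuclideanSpace ℝ (Fin (d + 1))) 0 := by
  simp [sphereInner, pole, EuclideanSpace.inner_single_right]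

/-- Sum the integration by parts over the `d` coordinates other than the first, whose squares add up
to `1 - t²`. -/
theorem sphereMean_pow (d n : ℕ) :
    n * sphereMean d (fun t => t ^ (n - 1) * (1 - t ^ 2)) = d * sphereMean d (fun t => t ^ (n + 1)) := by
  have h := Finset.sum_congr rfl fun (j : Fin (d + 1)) (hj : j ∈ Finset.univ.erase 0) =>
    integral_pow_mul_sq n j (Finset.ne_of_mem_erase hj)
  have hco : ∀ i, Continuous fun x : UnitSphere d => (x : EuclideanSpace ℝ (Fin (d + 1))) i :=
    fun i => by fun_prop
  rw [← Finset.mul_sum, ← integral_finsetSum, Finset.sum_const, Finset.card_erase_of_mem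
    (Finset.mem_univ _), Finset.card_univ, Fintype.card_fin, Nat.add_sub_cancel, nsmul_eq_mul] at h
  · simp only [sphereMean, sphereInner_pole]
    rw [← h]
    congr 2
    ext x
    rw [← Finset.mul_sum]
    congr 1
    have hn := norm_unitSphere x
    rw [EuclideanSpace.norm_eq, Real.sqrt_eq_one] at hn
    simp only [Real.norm_eq_abs, sq_abs] at hn
    rw [← Finset.add_sum_erase _ _ (Finset.mem_univ (0 : Fin (d + 1)))] at hn
    linarith
  · intro j _
    exact integrable_sphereMeasure (((hco 0).pow _).mul ((hco j).pow _))

/-- The mean of a polynomial zonal function, as a linear functional. -/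
noncomputable def sphereMeanPoly (d : ℕ) : ℝ[X] →ₗ[ℝ] ℝ where
  toFun p := sphereMean d fun t => p.eval t
  map_add' p q := by
    simpa only [eval_add] using sphereMean_add p.continuousOn q.continuousOn
  map_smul' a p := by
    simpa only [eval_smul, smul_eq_mul, RingHom.id_apply] using sphereMean_const_mul a fun t => p.eval t

theorem sphereMeanPoly_apply (p : ℝ[X]) :
    sphereMeanPoly d p = sphereMean d fun t => p.eval t := rfl

/-- In terms of the density `(1 - t²)^((d-2)/2)` this is the integral of the derivative of `(1 -
t²)^(d/2) r`. The density is never computed: on monomials the claim is `sphereMean_pow`. -/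
theorem sphereMeanPoly_derivative (r : ℝ[X]) :
    sphereMeanPoly d ((1 - X ^ 2) * derivative r - C (d : ℝ) * X * r) = 0 := by
  induction r using Polynomial.induction_on' with
  | add p q hp hq =>
    have : (1 - X ^ 2) * derivative (p + q) - C (d : ℝ) * X * (p + q) =
        ((1 - X ^ 2) * derivative p - C (d : ℝ) * X * p) +
          ((1 - X ^ 2) * derivative q - C (d : ℝ) * X * q) := by
      rw [derivative_add]; ring
    rw [this, map_add, hp, hq, add_zero]
  | monomial n a =>
    have : (1 - X ^ 2) * derivative (monomial n a) - C (d : ℝ) * X * monomial n a =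
        a • ((n : ℝ) • (X ^ (n - 1) * (1 - X ^ 2)) - (d : ℝ) • X ^ (n + 1)) := by
      rw [derivative_monomial, ← C_mul_X_pow_eq_monomial, ← C_mul_X_pow_eq_monomial]
      simp only [smul_eq_C_mul, map_mul]
      ring
    rw [this, map_smul, map_sub, map_smul, map_smul, sphereMeanPoly_apply, sphereMeanPoly_apply]
    have h := sphereMean_pow d n
    simp only [eval_mul, eval_pow, eval_X, eval_sub, eval_one, smul_eq_mul]
    rw [h]; simp

theorem sphereMeanPoly_gegenbauer_orthogonal (hd : 2 ≤ d) {k l : ℕ} (hkl : k ≠ l) :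
    sphereMeanPoly d (gegenbauerPoly (((d : ℝ) - 1) / 2) k *
      gegenbauerPoly (((d : ℝ) - 1) / 2) l) = 0 := by
  set lam : ℝ := ((d : ℝ) - 1) / 2 with hlam
  have hd' : (2 : ℝ) ≤ d := by exact_mod_cast hd
  set P := gegenbauerPoly lam k
  set Q := gegenbauerPoly lam l
  have hP : _ = _ := gegenbauerPoly_ode lam k
  have hQ : _ = _ := gegenbauerPoly_ode lam l
  -- Sturm–Liouville argument: the Wronskian produces `P Q` times the difference of the two
  -- eigenvalues.
  have h := sphereMeanPoly_derivative (d := d) (P * derivative Q - Q * derivative P)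
  have hdl : C (d : ℝ) = 2 * C lam + 1 := by
    rw [show (d : ℝ) = 2 * lam + 1 by rw [hlam]; ring]
    simp only [map_add, map_mul, map_ofNat, map_one]
  have hr : (1 - X ^ 2) * derivative (P * derivative Q - Q * derivative P) -
      C (d : ℝ) * X * (P * derivative Q - Q * derivative P) =
      ((k : ℝ) * (k + 2 * lam) - l * (l + 2 * lam)) • (P * Q) := by
    simp only [map_sub, derivative_mul, hdl, smul_eq_C_mul, map_add, map_mul,
      map_natCast, map_ofNat]
    linear_combination P * hQ - Q * hP
  rw [hr, map_smul, smul_eq_mul] at h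
  refine (mul_eq_zero.1 h).resolve_left ?_
  have hf : (k : ℝ) * (k + 2 * lam) - l * (l + 2 * lam) = (k - l) * (k + l + 2 * lam) := by ring
  rw [hf]
  have hne : (k : ℝ) - l ≠ 0 := sub_ne_zero.2 (by exact_mod_cast hkl)
  have : 0 < (k : ℝ) + l + 2 * lam := by
    have : 0 < lam := by rw [hlam]; linarith
    positivity
  exact mul_ne_zero hne this.ne'

end SphereMean

/-! ### Schoenberg's theorem -/

section Schoenberg

open MeasureTheory

variable {d : ℕ} {f : ℝ → ℝ}

/-- Integration of polynomials against a continuous zonal function. -/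
noncomputable def zonalPairing (d : ℕ) (f : ℝ → ℝ) (hf : ContinuousOn f (Set.Icc (-1) 1)) :
    ℝ[X] →ₗ[ℝ] ℝ where
  toFun p := sphereMean d fun t => f t * p.eval t
  map_add' p q := by
    simp only [eval_add, mul_add]
    exact sphereMean_add (hf.mul p.continuousOn) (hf.mul q.continuousOn)
  map_smul' a p := by
    simpa only [eval_smul, smul_eq_mul, RingHom.id_apply, mul_left_comm] using
      sphereMean_const_mul a fun t => f t * p.eval t

theorem zonalPairing_apply (hf : ContinuousOn f (Set.Icc (-1) 1)) (p : ℝ[X]) :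
    zonalPairing d f hf p = sphereMean d fun t => f t * p.eval t := rfl

/-- The Gegenbauer polynomials attached to the sphere `S^d`. -/
noncomputable def sphereGegenbauer (d k : ℕ) : ℝ[X] := gegenbauerPoly (((d : ℝ) - 1) / 2) k

theorem half_sub_one_pos (hd : 2 ≤ d) : 0 < ((d : ℝ) - 1) / 2 := by
  have hd' : (2 : ℝ) ≤ d := by exact_mod_cast hd
  linarith

theorem sphereGegenbauer_one_pos (hd : 2 ≤ d) (k : ℕ) : 0 < (sphereGegenbauer d k).eval 1 :=
  gegenbauerPoly_eval_one_pos (half_sub_one_pos hd) k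

theorem abs_sphereGegenbauer_le (hd : 2 ≤ d) {t : ℝ} (ht : t ∈ Set.Icc (-1 : ℝ) 1) (k : ℕ) :
    |(sphereGegenbauer d k).eval t| ≤ (sphereGegenbauer d k).eval 1 :=
  abs_gegenbauerPoly_eval_le (half_sub_one_pos hd) ht k

theorem sphereMeanPoly_sq_pos (hd : 2 ≤ d) (k : ℕ) :
    0 < sphereMeanPoly d (sphereGegenbauer d k * sphereGegenbauer d k) := by
  rw [sphereMeanPoly_apply]
  refine sphereMean_pos (by omega) (Polynomial.continuousOn _) (fun t _ => ?_)
    (t := 1) (by norm_num) ?_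
  · rw [eval_mul]; exact mul_self_nonneg _
  · rw [eval_mul]; exact (mul_self_pos.2 (sphereGegenbauer_one_pos hd k).ne').ne'

/-- The Gegenbauer coefficients of a continuous function. -/
noncomputable def gegenbauerCoeff (d : ℕ) (f : ℝ → ℝ) (k : ℕ) : ℝ :=
  sphereMean d (fun t => f t * (sphereGegenbauer d k).eval t) /
    sphereMeanPoly d (sphereGegenbauer d k * sphereGegenbauer d k)

theorem IsIsotropicPartPD.gegenbauerCoeff_nonneg (hd : 2 ≤ d) (hf : IsIsotropicPartPD d f) (k : ℕ) :
    0 ≤ gegenbauerCoeff d f k :=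
  div_nonneg (hf.mul (isIsotropicPartPD_gegenbauerPoly hd k)).sphereMean_nonneg
    (sphereMeanPoly_sq_pos hd k).le

/-- Parseval's identity with one polynomial factor. The polynomial is a finite combination of
Gegenbauer polynomials, so no convergence enters; `s` is the support of that combination. -/
theorem zonalPairing_eq_sum (hd : 2 ≤ d) (hf : ContinuousOn f (Set.Icc (-1) 1)) (p : ℝ[X]) :
    ∃ s : Finset ℕ, (∀ k ∉ s, sphereMeanPoly d (p * sphereGegenbauer d k) = 0) ∧
      zonalPairing d f hf p =
        ∑ k ∈ s, gegenbauerCoeff d f k * sphereMeanPoly d (p * sphereGegenbauer d k) := by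
  have hp : p ∈ Submodule.span ℝ (Set.range (sphereGegenbauer d)) := by
    have h := span_gegenbauerPoly (half_sub_one_pos hd)
    change Submodule.span ℝ (Set.range (sphereGegenbauer d)) = ⊤ at h
    rw [h]; trivial
  obtain ⟨c, rfl⟩ := Finsupp.mem_span_range_iff_exists_finsupp.1 hp
  have hk : ∀ k, sphereMeanPoly d ((c.sum fun i a => a • sphereGegenbauer d i) *
      sphereGegenbauer d k) =
        c k * sphereMeanPoly d (sphereGegenbauer d k * sphereGegenbauer d k) := by
    intro k
    rw [Finsupp.sum, Finset.sum_mul, map_sum, Finset.sum_eq_single k]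
    · rw [smul_mul_assoc, map_smul, smul_eq_mul]
    · intro l _ hl
      rw [smul_mul_assoc, map_smul]
      unfold sphereGegenbauer
      rw [sphereMeanPoly_gegenbauer_orthogonal hd hl, smul_zero]
    · intro h
      rw [Finsupp.notMem_support_iff.1 h]; simp
  refine ⟨c.support, fun k h => ?_, ?_⟩
  · rw [hk, Finsupp.notMem_support_iff.1 h, zero_mul]
  · rw [Finsupp.sum, map_sum]
    refine Finset.sum_congr rfl fun k _ => ?_
    have h := hk k
    rw [Finsupp.sum] at h
    rw [h, map_smul, smul_eq_mul, zonalPairing_apply, gegenbauerCoeff]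
    have := (sphereMeanPoly_sq_pos hd k).ne'
    field_simp

theorem tendsto_sphereMean_peak {h : ℝ → ℝ} (hc : ContinuousOn h (Set.Icc (-1) 1)) :
    Tendsto (fun n : ℕ => (sphereMean d fun t => ((1 + t) / 2) ^ n)⁻¹ *
      sphereMean d fun t => ((1 + t) / 2) ^ n * h t) atTop (𝓝 (h 1)) := by
  have hcont : Continuous fun x : UnitSphere d => (1 + sphereInner x (pole d)) / 2 :=
    (continuous_const.add (continuous_sphereInner_left _)).div_const _
  have := tendsto_setIntegral_pow_smul_of_unique_maximum_of_isCompact_of_continuousOn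
    (μ := sphereMeasure d) (s := Set.univ) (x₀ := pole d) isCompact_univ
    (c := fun x => (1 + sphereInner x (pole d)) / 2)
    (g := fun x => h (sphereInner x (pole d))) hcont.continuousOn
    (fun y _ hy => by
      have h1 : sphereInner y (pole d) < 1 :=
        lt_of_le_of_ne (sphereInner_mem _ _).2 fun h => hy (sphereInner_eq_one_iff.1 h)
      simp only [sphereInner_self]
      linarith)
    (fun y _ => by
      have h1 := (sphereInner_mem y (pole d)).1
      linarith)
    (by simp [sphereInner_self]) (by simp)
    (continuous_comp_sphereInner hc _).continuousOn
  simpa only [Measure.restrict_univ, smul_eq_mul, sphereInner_self, sphereMean] using this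

/-- Apply Parseval to the peak `((1+t)/2)^n`. All terms are nonnegative, as means of positive
definite functions, so a partial sum is at most the pairing with `f`. Dividing by the mean of the
peak and letting `n → ∞` evaluates both sides at `1`. -/
theorem IsIsotropicPartPD.sum_gegenbauerCoeff_le (hd : 2 ≤ d) (hf : IsIsotropicPartPD d f)
    (N : ℕ) : ∑ k ∈ Finset.range N, gegenbauerCoeff d f k * (sphereGegenbauer d k).eval 1 ≤ f 1 := by
  have hpd := isIsotropicPartPD_half_one_add (d := d)
  have hle : ∀ n : ℕ, ∑ k ∈ Finset.range N, gegenbauerCoeff d f k *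
      ((sphereMean d fun t => ((1 + t) / 2) ^ n)⁻¹ *
        sphereMean d fun t => ((1 + t) / 2) ^ n * (sphereGegenbauer d k).eval t) ≤
      (sphereMean d fun t => ((1 + t) / 2) ^ n)⁻¹ *
        sphereMean d fun t => ((1 + t) / 2) ^ n * f t := by
    intro n
    set p : ℝ[X] := (C (1 / 2) * (1 + X)) ^ n with hp
    have hpe : ∀ t, p.eval t = ((1 + t) / 2) ^ n := by
      intro t; simp [hp]; ring
    have hM : ∀ k, sphereMeanPoly d (p * sphereGegenbauer d k) =
        sphereMean d fun t => ((1 + t) / 2) ^ n * (sphereGegenbauer d k).eval t := by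
      intro k
      simp only [sphereMeanPoly_apply, eval_mul, hpe]
    have hA : zonalPairing d f hf.1 p = sphereMean d fun t => ((1 + t) / 2) ^ n * f t := by
      simp only [zonalPairing_apply, hpe, mul_comm]
    obtain ⟨s, hs0, hs⟩ := zonalPairing_eq_sum hd hf.1 p
    have hnn : ∀ k, 0 ≤ gegenbauerCoeff d f k * sphereMeanPoly d (p * sphereGegenbauer d k) := by
      intro k
      refine mul_nonneg (hf.gegenbauerCoeff_nonneg hd k) ?_
      rw [hM]
      exact ((hpd.pow n).mul (isIsotropicPartPD_gegenbauerPoly hd k)).sphereMean_nonneg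
    have hsum : ∑ k ∈ Finset.range N, gegenbauerCoeff d f k *
        sphereMeanPoly d (p * sphereGegenbauer d k) ≤ zonalPairing d f hf.1 p := by
      rw [hs]
      classical
      refine (Finset.sum_le_sum_of_subset_of_nonneg (Finset.subset_union_left (s₂ := s))
        fun k _ _ => hnn k).trans (Finset.sum_subset Finset.subset_union_right ?_).ge
      intro k _ hk
      rw [hs0 k hk, mul_zero]
    rw [hA] at hsum
    simp only [hM] at hsum
    have := mul_le_mul_of_nonneg_left hsum (inv_nonneg.2 (hpd.pow n).sphereMean_nonneg)
    rw [Finset.mul_sum] at this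
    simpa only [mul_left_comm] using this
  refine le_of_tendsto_of_tendsto' (tendsto_finsetSum _ fun k _ =>
    (tendsto_sphereMean_peak (Polynomial.continuousOn _)).const_mul _)
      (tendsto_sphereMean_peak hf.1) hle

theorem sphereMean_tsum_mul (hd : 2 ≤ d) {a : ℕ → ℝ} (ha : ∀ k, 0 ≤ a k)
    (hs : Summable fun k => a k * (sphereGegenbauer d k).eval 1) (j : ℕ) :
    sphereMean d (fun t => (∑' k, a k * (sphereGegenbauer d k).eval t) *
      (sphereGegenbauer d j).eval t) =
      a j * sphereMeanPoly d (sphereGegenbauer d j * sphereGegenbauer d j) := by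
  have hcont : ∀ k, Continuous fun x : UnitSphere d =>
      a k * (sphereGegenbauer d k).eval (sphereInner x (pole d)) *
        (sphereGegenbauer d j).eval (sphereInner x (pole d)) := fun k =>
    continuous_comp_sphereInner (h := fun t => a k * (sphereGegenbauer d k).eval t *
        (sphereGegenbauer d j).eval t)
      ((continuousOn_const.mul (Polynomial.continuousOn _)).mul (Polynomial.continuousOn _)) _
  have hsum : Summable fun k => ∫ x : UnitSphere d,
      ‖a k * (sphereGegenbauer d k).eval (sphereInner x (pole d)) *
        (sphereGegenbauer d j).eval (sphereInner x (pole d))‖ ∂sphereMeasure d := by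
    refine Summable.of_nonneg_of_le (fun k => integral_nonneg fun _ => norm_nonneg _) (fun k => ?_)
      (hs.mul_right ((sphereGegenbauer d j).eval 1 * (sphereMeasure d).real Set.univ))
    calc _ ≤ ∫ _ : UnitSphere d, a k * (sphereGegenbauer d k).eval 1 *
          (sphereGegenbauer d j).eval 1 ∂sphereMeasure d := by
          refine integral_mono (integrable_sphereMeasure (hcont k)).norm (integrable_const _)
            fun x => ?_
          simp only [norm_mul, Real.norm_eq_abs, abs_of_nonneg (ha k)]
          have h1 := abs_sphereGegenbauer_le hd (sphereInner_mem x (pole d)) k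
          have h2 := abs_sphereGegenbauer_le hd (sphereInner_mem x (pole d)) j
          have h3 := (sphereGegenbauer_one_pos hd k).le
          have h4 := ha k
          gcongr
      _ = _ := by rw [integral_const, smul_eq_mul]; ring
  have h := hasSum_integral_of_summable_integral_norm
    (fun k => integrable_sphereMeasure (hcont k)) hsum
  have hL : sphereMean d (fun t => (∑' k, a k * (sphereGegenbauer d k).eval t) *
      (sphereGegenbauer d j).eval t) = ∫ x : UnitSphere d,
        ∑' k, a k * (sphereGegenbauer d k).eval (sphereInner x (pole d)) *
        (sphereGegenbauer d j).eval (sphereInner x (pole d)) ∂sphereMeasure d := by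
    simp only [sphereMean, tsum_mul_right]
  have hterm : ∀ k, ∫ x : UnitSphere d,
      a k * (sphereGegenbauer d k).eval (sphereInner x (pole d)) *
        (sphereGegenbauer d j).eval (sphereInner x (pole d)) ∂sphereMeasure d =
      a k * sphereMeanPoly d (sphereGegenbauer d k * sphereGegenbauer d j) := by
    intro k
    simp only [mul_assoc, integral_const_mul, sphereMeanPoly_apply, sphereMean, eval_mul]
  simp only [hterm] at h
  rw [hL]
  refine h.unique ?_
  refine hasSum_single j fun k hk => ?_
  unfold sphereGegenbauer
  rw [sphereMeanPoly_gegenbauer_orthogonal hd hk, mul_zero]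

/-- All pairings of `u` with polynomials vanish. By Weierstrass approximation the mean of `u²` must
then vanish, and the surface measure charges every open set. -/
theorem eqOn_zero_of_zonalPairing_eq_zero (hd : 2 ≤ d) {u : ℝ → ℝ}
    (hu : ContinuousOn u (Set.Icc (-1) 1)) (h : ∀ k, zonalPairing d u hu (sphereGegenbauer d k) = 0)
    {t : ℝ} (ht : t ∈ Set.Icc (-1 : ℝ) 1) : u t = 0 := by
  have hall : ∀ p, zonalPairing d u hu p = 0 := by
    intro p
    obtain ⟨s, -, hs⟩ := zonalPairing_eq_sum hd hu p
    rw [hs]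
    refine Finset.sum_eq_zero fun k _ => ?_
    have := h k
    rw [zonalPairing_apply] at this
    rw [gegenbauerCoeff, this, zero_div, zero_mul]
  by_contra hne
  have hpos : 0 < sphereMean d fun t => u t * u t :=
    sphereMean_pos (by omega) (hu.mul hu) (fun _ _ => mul_self_nonneg _) ht (mul_self_ne_zero.2 hne)
  have hone : 0 < sphereMean d fun _ => 1 :=
    sphereMean_pos (by omega) continuousOn_const (fun _ _ => zero_le_one) ht one_ne_zero
  set S := sphereMean d fun t => u t * u t
  set m := sphereMean d fun _ => 1
  -- With this tolerance the mean of `(u - p)²` is at most `S / 2`. It also dominates the mean of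
  -- `u² - 2up`, which is `S`.
  obtain ⟨p, hp⟩ := exists_polynomial_near_of_continuousOn (-1) 1 u hu √(S / (2 * m))
    (Real.sqrt_pos.2 (by positivity))
  have h1 : sphereMean d (fun t => u t * u t + (-2) * (u t * p.eval t)) ≤
      sphereMean d (fun _ => S / (2 * m) * 1) := by
    refine sphereMean_mono ((hu.mul hu).add (continuousOn_const.mul (hu.mul p.continuousOn)))
      continuousOn_const fun t ht => ?_
    have h2 := sq_le_sq' (abs_lt.1 (hp t ht)).1.le (abs_lt.1 (hp t ht)).2.le
    rw [Real.sq_sqrt (by positivity)] at h2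
    nlinarith [sq_nonneg (p.eval t)]
  have h4 : sphereMean d (fun t => u t * u t + (-2) * (u t * p.eval t)) =
      S + sphereMean d (fun t => (-2) * (u t * p.eval t)) :=
    sphereMean_add (hu.mul hu) (continuousOn_const.mul (hu.mul p.continuousOn))
  rw [h4, sphereMean_const_mul, sphereMean_const_mul, ← zonalPairing_apply hu, hall] at h1
  have h3 : S / (2 * m) * m = S / 2 := by field_simp
  change S + -2 * 0 ≤ S / (2 * m) * m at h1
  rw [h3] at h1
  linarith

/-- Schoenberg's theorem: isotropic parts of positive definite kernels on `S^d` have nonnegative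
Gegenbauer expansions. -/
theorem IsIsotropicPartPD.exists_isGegenbauerExpansion (hd : 2 ≤ d) (hf : IsIsotropicPartPD d f) :
    ∃ a : ℕ → ℝ, IsGegenbauerExpansion d f a := by
  set a := gegenbauerCoeff d f with ha
  have ha0 : ∀ k, 0 ≤ a k := hf.gegenbauerCoeff_nonneg hd
  have hs : Summable fun k => a k * (sphereGegenbauer d k).eval 1 :=
    summable_of_sum_range_le
      (fun k => mul_nonneg (ha0 k) (sphereGegenbauer_one_pos hd k).le)
      (hf.sum_gegenbauerCoeff_le hd)
  have hbound : ∀ k, ∀ t ∈ Set.Icc (-1 : ℝ) 1, ‖a k * (sphereGegenbauer d k).eval t‖ ≤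
      a k * (sphereGegenbauer d k).eval 1 := by
    intro k t ht
    rw [norm_mul, Real.norm_eq_abs, Real.norm_eq_abs, abs_of_nonneg (ha0 k)]
    exact mul_le_mul_of_nonneg_left (abs_sphereGegenbauer_le hd ht k) (ha0 k)
  have hg : ContinuousOn (fun t => ∑' k, a k * (sphereGegenbauer d k).eval t) (Set.Icc (-1) 1) :=
    continuousOn_tsum (fun k => continuousOn_const.mul (Polynomial.continuousOn _)) hs hbound
  refine ⟨a, ha0, fun t ht => ?_⟩
  have hsum : Summable fun k => a k * (sphereGegenbauer d k).eval t :=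
    Summable.of_norm_bounded hs fun k => hbound k t ht
  have hz := eqOn_zero_of_zonalPairing_eq_zero hd
    (u := fun t => f t + (-1) * ∑' k, a k * (sphereGegenbauer d k).eval t)
    (hf.1.add (continuousOn_const.mul hg)) (fun j => ?_) ht
  · have : f t = ∑' k, a k * (sphereGegenbauer d k).eval t := by
      linarith
    rw [this]
    exact hsum.hasSum
  · rw [zonalPairing_apply]
    simp only [add_mul, mul_assoc]
    have h1 : sphereMean d (fun t => f t * (sphereGegenbauer d j).eval t + (-1) *
        ((∑' k, a k * (sphereGegenbauer d k).eval t) * (sphereGegenbauer d j).eval t)) =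
        sphereMean d (fun t => f t * (sphereGegenbauer d j).eval t) + sphereMean d (fun t => (-1) *
        ((∑' k, a k * (sphereGegenbauer d k).eval t) * (sphereGegenbauer d j).eval t)) :=
      sphereMean_add (hf.1.mul (Polynomial.continuousOn _))
        (continuousOn_const.mul (hg.mul (Polynomial.continuousOn _)))
    rw [h1, sphereMean_const_mul,
      sphereMean_tsum_mul hd ha0 hs, ha, gegenbauerCoeff,
      div_mul_cancel₀ _ (sphereMeanPoly_sq_pos hd j).ne']
    ring

end Schoenberg

/-! ### Strict positive definiteness of products -/

section Strict

variable {d : ℕ} {f g : ℝ → ℝ} {a b : ℕ → ℝ}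

theorem hasSum_mul_gegenbauer (ha : IsGegenbauerExpansion d f a)
    (hb : IsGegenbauerExpansion d g b) {t : ℝ} (ht : t ∈ Set.Icc (-1 : ℝ) 1) :
    HasSum (fun p : ℕ × ℕ => a p.1 * b p.2 *
      ((sphereGegenbauer d p.1).eval t * (sphereGegenbauer d p.2).eval t)) (f t * g t) := by
  have h1 := ha.2 t ht
  have h2 := hb.2 t ht
  have h := h1.mul h2 (summable_mul_of_summable_norm h1.summable.norm h2.summable.norm)
  refine h.congr_fun fun p => ?_
  simp only [sphereGegenbauer]
  ring

theorem hasSum_sphereForm_mul (ha : IsGegenbauerExpansion d f a)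
    (hb : IsGegenbauerExpansion d g b) {ι : Type*} [Fintype ι] (x : ι → UnitSphere d)
    (c : ι → ℝ) :
    HasSum (fun p : ℕ × ℕ => a p.1 * b p.2 *
      sphereForm (fun t => (sphereGegenbauer d p.1).eval t * (sphereGegenbauer d p.2).eval t) x c)
      (sphereForm (fun t => f t * g t) x c) := by
  have h := hasSum_sum fun i (_ : i ∈ Finset.univ) => hasSum_sum fun j (_ : j ∈ Finset.univ) =>
    (hasSum_mul_gegenbauer ha hb (sphereInner_mem (x i) (x j))).mul_left (c i * c j)
  refine h.congr_fun fun p => ?_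
  simp only [sphereForm, Finset.mul_sum]
  exact Finset.sum_congr rfl fun i _ => Finset.sum_congr rfl fun j _ => by ring

theorem isIsotropicPartPD_sphereGegenbauer_mul (hd : 2 ≤ d) (k l : ℕ) :
    IsIsotropicPartPD d fun t => (sphereGegenbauer d k).eval t * (sphereGegenbauer d l).eval t :=
  (isIsotropicPartPD_gegenbauerPoly hd k).mul (isIsotropicPartPD_gegenbauerPoly hd l)

/-- A vector in the kernel of the form of `C_k C_l` is annihilated by the matrix of the
normalized product. -/
theorem sum_ratio_eq_zero (hd : 2 ≤ d) {ι : Type*} [Fintype ι] (x : ι → UnitSphere d) (c : ι → ℝ)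
    {k l : ℕ} (h : sphereForm (fun t => (sphereGegenbauer d k).eval t *
      (sphereGegenbauer d l).eval t) x c = 0) (i : ι) :
    ∑ j, c j * (gegenbauerRatio (((d : ℝ) - 1) / 2) k (sphereInner (x i) (x j)) *
      gegenbauerRatio (((d : ℝ) - 1) / 2) l (sphereInner (x i) (x j))) = 0 := by
  have hpsd := (isIsotropicPartPD_sphereGegenbauer_mul hd k l).posSemidef x
  rw [sphereForm_eq] at h
  have h2 := congrFun ((hpsd.dotProduct_mulVec_zero_iff c).1 (by simpa using h)) i
  simp only [Matrix.mulVec, dotProduct, sphereMatrix, Matrix.of_apply, Pi.zero_apply] at h2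
  have hk := sphereGegenbauer_one_pos hd k
  have hl := sphereGegenbauer_one_pos hd l
  have : ∑ j, c j * (gegenbauerRatio (((d : ℝ) - 1) / 2) k (sphereInner (x i) (x j)) *
      gegenbauerRatio (((d : ℝ) - 1) / 2) l (sphereInner (x i) (x j))) =
      (∑ j, (sphereGegenbauer d k).eval (sphereInner (x i) (x j)) *
        (sphereGegenbauer d l).eval (sphereInner (x i) (x j)) * c j) /
        ((sphereGegenbauer d k).eval 1 * (sphereGegenbauer d l).eval 1) := by
    rw [Finset.sum_div]
    refine Finset.sum_congr rfl fun j _ => ?_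
    simp only [gegenbauerRatio, sphereGegenbauer]
    ring
  rw [this, h2, zero_div]

/-- Neither degree need tend to infinity by itself, but one of them is at least `n / 2`; that factor
is small and the other is at most `1` in absolute value. -/
theorem tendsto_ratio_mul_ratio {lam : ℝ} (hl : 0 < lam) {t : ℝ} (h1 : -1 < t) (h2 : t < 1)
    {k l : ℕ → ℕ} (hkl : ∀ n, n ≤ k n + l n) :
    Tendsto (fun n => gegenbauerRatio lam (k n) t * gegenbauerRatio lam (l n) t) atTop (𝓝 0) := by
  have ht : t ∈ Set.Icc (-1 : ℝ) 1 := ⟨h1.le, h2.le⟩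
  have h := tendsto_gegenbauerRatio hl h1 h2
  rw [Metric.tendsto_atTop] at h ⊢
  intro e he
  obtain ⟨N, hN⟩ := h e he
  refine ⟨2 * N, fun n hn => ?_⟩
  rw [Real.dist_eq, sub_zero, abs_mul]
  have hb := abs_gegenbauerRatio_le_one hl ht
  simp only [Real.dist_eq, sub_zero] at hN
  have hnk := hkl n
  rcases le_total N (k n) with hk | hk
  · calc _ ≤ |gegenbauerRatio lam (k n) t| * 1 :=
        mul_le_mul_of_nonneg_left (hb _) (abs_nonneg _)
      _ < e := by rw [mul_one]; exact hN _ hk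
  · calc _ ≤ 1 * |gegenbauerRatio lam (l n) t| :=
        mul_le_mul_of_nonneg_right (hb _) (abs_nonneg _)
      _ < e := by rw [one_mul]; exact hN _ (by omega)

/-- Along degrees of constant parity, the coefficient at a point is determined up to sign by the
coefficients at its antipode. -/
theorem coeff_add_antipode_eq_zero (hd : 2 ≤ d) {ι : Type*} [Fintype ι] [DecidableEq ι]
    {x : ι → UnitSphere d} (hx : Function.Injective x) (c : ι → ℝ) (e : ℝ)
    {k l : ℕ → ℕ} (hkl : ∀ n, n ≤ k n + l n) (hpar : ∀ n, (-1 : ℝ) ^ (k n + l n) = e)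
    (h : ∀ n, sphereForm (fun t => (sphereGegenbauer d (k n)).eval t *
      (sphereGegenbauer d (l n)).eval t) x c = 0) (i : ι) :
    c i + e * ∑ j, (if sphereInner (x i) (x j) = -1 then c j else 0) = 0 := by
  have hl := half_sub_one_pos hd
  set lam := ((d : ℝ) - 1) / 2
  have hlim : Tendsto (fun n => ∑ j, c j * (gegenbauerRatio lam (k n) (sphereInner (x i) (x j)) *
      gegenbauerRatio lam (l n) (sphereInner (x i) (x j)))) atTop
      (𝓝 (∑ j, ((if j = i then c j else 0) +
        e * (if sphereInner (x i) (x j) = -1 then c j else 0)))) := by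
    refine tendsto_finsetSum _ fun j _ => ?_
    by_cases hj : j = i
    · subst hj
      have hne : (1 : ℝ) ≠ -1 := by norm_num
      simp [sphereInner_self, gegenbauerRatio_apply_one hl, hne]
    by_cases ha : sphereInner (x i) (x j) = -1
    · simp only [hj, ha, if_true, if_false, gegenbauerRatio_apply_neg_one hl, ← pow_add, hpar]
      rw [zero_add, mul_comm]
      exact tendsto_const_nhds
    · have h1 : sphereInner (x i) (x j) < 1 :=
        lt_of_le_of_ne (sphereInner_mem _ _).2 fun h1 =>
          hj (hx (sphereInner_eq_one_iff.1 h1)).symm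
      have h2 : -1 < sphereInner (x i) (x j) :=
        lt_of_le_of_ne (sphereInner_mem _ _).1 (Ne.symm ha)
      simpa [hj, ha] using (tendsto_ratio_mul_ratio hl h2 h1 hkl).const_mul (c j)
  have hz : ∀ n, _ = _ := fun n => sum_ratio_eq_zero hd x c (h n) i
  simp only [lam, hz] at hlim
  have := tendsto_nhds_unique hlim tendsto_const_nhds
  rw [Finset.sum_add_distrib, ← Finset.mul_sum] at this
  simpa using this

theorem exists_seq_of_infinite {P : ℕ → Prop} (h : {m ∈ sumSupport a b | P m}.Infinite) :
    ∃ k l : ℕ → ℕ, ∀ n, n ≤ k n + l n ∧ P (k n + l n) ∧ 0 < a (k n) * b (l n) := by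
  have : ∀ n, ∃ k l, n ≤ k + l ∧ P (k + l) ∧ 0 < a k * b l := by
    intro n
    obtain ⟨m, ⟨⟨k, l, hkl, rfl⟩, hP⟩, hn⟩ := h.exists_gt n
    exact ⟨k, l, hn.le, hP, hkl⟩
  choose k l h using this
  exact ⟨k, l, h⟩

theorem isIsotropicPartSPD_mul_of_infinite (hd : 2 ≤ d) (hf : IsIsotropicPartPD d f)
    (hg : IsIsotropicPartPD d g) (ha : IsGegenbauerExpansion d f a)
    (hb : IsGegenbauerExpansion d g b)
    (heven : {m ∈ sumSupport a b | Even m}.Infinite)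
    (hodd : {m ∈ sumSupport a b | Odd m}.Infinite) :
    IsIsotropicPartSPD d fun t => f t * g t := by
  refine ⟨hf.mul hg, fun n x hx c hc => ?_⟩
  simp only [isotropicKernel_eq_sphereInner]
  change 0 < sphereForm (fun t => f t * g t) x c
  refine lt_of_le_of_ne ((hf.mul hg).sphereForm_nonneg x c) fun h0 => hc ?_
  have hsum := hasSum_sphereForm_mul ha hb x c
  have hnn : ∀ p : ℕ × ℕ, 0 ≤ a p.1 * b p.2 * sphereForm (fun t =>
      (sphereGegenbauer d p.1).eval t * (sphereGegenbauer d p.2).eval t) x c := fun p =>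
    mul_nonneg (mul_nonneg (ha.1 _) (hb.1 _))
      ((isIsotropicPartPD_sphereGegenbauer_mul hd _ _).sphereForm_nonneg x c)
  rw [← h0, hasSum_zero_iff_of_nonneg hnn] at hsum
  have hzero : ∀ k l, 0 < a k * b l → sphereForm (fun t =>
      (sphereGegenbauer d k).eval t * (sphereGegenbauer d l).eval t) x c = 0 := fun k l hkl =>
    (mul_eq_zero.1 (congrFun hsum (k, l))).resolve_left hkl.ne'
  obtain ⟨k, l, hkl⟩ := exists_seq_of_infinite heven
  obtain ⟨k', l', hkl'⟩ := exists_seq_of_infinite hodd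
  ext i
  have h1 := coeff_add_antipode_eq_zero hd hx c 1 (fun n => (hkl n).1)
    (fun n => (hkl n).2.1.neg_one_pow) (fun n => hzero _ _ (hkl n).2.2) i
  have h2 := coeff_add_antipode_eq_zero hd hx c (-1) (fun n => (hkl' n).1)
    (fun n => (hkl' n).2.1.neg_one_pow) (fun n => hzero _ _ (hkl' n).2.2) i
  simp only [Pi.zero_apply]
  -- The even degrees give `c i + S = 0` and the odd ones `c i - S = 0`, with the same sum `S` over
  -- antipodes.
  linarith

/-! ### Necessity: degenerate antipodal configurations on a great circle -/

/-- Arbitrarily many points `(u, v)` of the open upper half circle admit coefficients annihilating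
all moments of bounded degree. -/
theorem exists_circle_moments_zero (K : ℕ) :
    ∃ (N : ℕ) (u v c : Fin N → ℝ), (∀ i, u i ^ 2 + v i ^ 2 = 1) ∧ (∀ i, 0 < v i) ∧
      Function.Injective u ∧ c ≠ 0 ∧
      ∀ p q, p < K → q < K → ∑ i, c i * (u i ^ p * v i ^ q) = 0 := by
  -- One more unknown weight than there are moment conditions, so a nonzero solution exists.
  set N := K * K + 1 with hN
  have hNpos : (0 : ℝ) < N := by rw [hN]; positivity
  set u : Fin N → ℝ := fun i => i / N with hu
  have hu0 : ∀ i, 0 ≤ u i := fun i => by simp only [hu]; positivity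
  have hu1 : ∀ i, u i < 1 := fun i => by
    simp only [hu]; rw [div_lt_one hNpos]; exact_mod_cast i.2
  have hsq : ∀ i, 0 < 1 - u i ^ 2 := fun i => by nlinarith [hu0 i, hu1 i]
  set v : Fin N → ℝ := fun i => √(1 - u i ^ 2) with hv
  let T : (Fin N → ℝ) →ₗ[ℝ] (Fin K × Fin K → ℝ) :=
    LinearMap.pi fun pq => ∑ i, (u i ^ (pq.1 : ℕ) * v i ^ (pq.2 : ℕ)) • LinearMap.proj i
  have hker : LinearMap.ker T ≠ ⊥ := by
    apply LinearMap.ker_ne_bot_of_finrank_lt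
    simp [hN]
  obtain ⟨c, hcT, hc⟩ := Submodule.exists_mem_ne_zero_of_ne_bot hker
  refine ⟨N, u, v, c, fun i => ?_, fun i => Real.sqrt_pos.2 (hsq i), fun i j hij => ?_, hc, ?_⟩
  · simp only [hv]; rw [Real.sq_sqrt (hsq i).le]; ring
  · simp only [hu] at hij
    rw [div_left_inj' hNpos.ne'] at hij
    exact Fin.ext (by exact_mod_cast hij)
  · intro p q hp hq
    have h := congrFun (LinearMap.mem_ker.1 hcT) (⟨p, hp⟩, ⟨q, hq⟩)
    simpa [T, mul_comm] using h

theorem sum_eval_eq_zero_of_moments {N K : ℕ} {u v c : Fin N → ℝ}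
    (h : ∀ p q, p < K → q < K → ∑ i, c i * (u i ^ p * v i ^ q) = 0) {P : ℝ[X]}
    (hP : P.natDegree < K) (r s : ℝ) : ∑ i, c i * P.eval (r * u i + s * v i) = 0 := by
  simp only [eval_eq_sum_range, Finset.mul_sum]
  rw [Finset.sum_comm]
  refine Finset.sum_eq_zero fun n hn => ?_
  have hnK : n < K := by have := Finset.mem_range.1 hn; omega
  simp only [add_pow, Finset.mul_sum]
  rw [Finset.sum_comm]
  refine Finset.sum_eq_zero fun m hm => ?_
  have hm' := Finset.mem_range.1 hm
  have := congrArg (fun z => P.coeff n * (n.choose m) * r ^ m * s ^ (n - m) * z)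
    (h m (n - m) (by omega) (by omega))
  simp only [mul_zero, Finset.mul_sum] at this
  rw [← this]
  refine Finset.sum_congr rfl fun i _ => ?_
  rw [mul_pow, mul_pow]
  ring

theorem natDegree_gegenbauerPoly_le (lam : ℝ) (k : ℕ) : (gegenbauerPoly lam k).natDegree ≤ k := by
  induction k using Nat.twoStepInduction with
  | zero => simp
  | one => rw [gegenbauerPoly]; compute_degree
  | more k h0 h1 =>
    rw [gegenbauerPoly]
    refine (natDegree_C_mul_le _ _).trans ((natDegree_sub_le _ _).trans (max_le ?_ ?_))
    · refine natDegree_mul_le.trans ?_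
      have := (natDegree_C_mul_le (2 * ((k : ℝ) + 1 + lam)) X).trans natDegree_X_le
      omega
    · exact (natDegree_C_mul_le _ _).trans (by omega)

/-- A family of points of a great circle together with its antipodes. -/
noncomputable def antipodalFamily (hd : 1 ≤ d) {ι : Type*} {u v : ι → ℝ}
    (huv : ∀ i, u i ^ 2 + v i ^ 2 = 1) : ι ⊕ ι → UnitSphere d :=
  Sum.elim (fun i => circlePoint hd (u i) (v i) (huv i))
    (fun i => circlePoint hd (-u i) (-v i) (by rw [neg_sq, neg_sq, huv i]))

theorem antipodalFamily_injective (hd : 1 ≤ d) {ι : Type*} {u v : ι → ℝ}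
    (huv : ∀ i, u i ^ 2 + v i ^ 2 = 1) (hv : ∀ i, 0 < v i) (hu : Function.Injective u) :
    Function.Injective (antipodalFamily hd huv) := by
  have key : ∀ a b a' b' : ℝ, a ^ 2 + b ^ 2 = 1 → a' ^ 2 + b' ^ 2 = 1 → a * a' + b * b' = 1 →
      a = a' ∧ b = b' := by
    intro a b a' b' h h' h1
    have h2 : (a - a') ^ 2 + (b - b') ^ 2 = 0 := by linear_combination h + h' - 2 * h1
    have h3 : (a - a') ^ 2 = 0 := by nlinarith [sq_nonneg (a - a'), sq_nonneg (b - b')]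
    have h4 : (b - b') ^ 2 = 0 := by nlinarith [sq_nonneg (a - a'), sq_nonneg (b - b')]
    exact ⟨sub_eq_zero.1 (pow_eq_zero_iff two_ne_zero |>.1 h3),
      sub_eq_zero.1 (pow_eq_zero_iff two_ne_zero |>.1 h4)⟩
  have huv' : ∀ i, (-u i) ^ 2 + (-v i) ^ 2 = 1 := fun i => by rw [neg_sq, neg_sq, huv i]
  rintro (i | i) (j | j) hij <;> have h1 := sphereInner_eq_one_iff.2 hij <;>
    simp only [antipodalFamily, Sum.elim_inl, Sum.elim_inr, sphereInner_circlePoint] at h1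
  · rw [hu (key _ _ _ _ (huv i) (huv j) h1).1]
  · linarith [(key _ _ _ _ (huv i) (huv' j) h1).2, hv i, hv j]
  · linarith [(key _ _ _ _ (huv' i) (huv j) h1).2, hv i, hv j]
  · rw [hu (neg_injective (key _ _ _ _ (huv' i) (huv' j) h1).1)]

/-- The two diagonal blocks contribute `1` and `e * e = 1`, the two mixed blocks `e * s` each. The
factor vanishes when the parity `s` of `h` is opposite to `e`. -/
theorem sphereForm_antipodalFamily (hd : 1 ≤ d) {ι : Type*} [Fintype ι] {u v : ι → ℝ}
    (huv : ∀ i, u i ^ 2 + v i ^ 2 = 1) (c : ι → ℝ) {e s : ℝ} (he : e * e = 1) {h : ℝ → ℝ}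
    (hneg : ∀ t, h (-t) = s * h t) :
    sphereForm h (antipodalFamily hd huv) (Sum.elim c fun i => e * c i) =
      (2 + 2 * e * s) * ∑ i, c i * ∑ j, c j * h (u i * u j + v i * v j) := by
  simp only [sphereForm, antipodalFamily, Fintype.sum_sum_type, Sum.elim_inl, Sum.elim_inr,
    sphereInner_circlePoint, ← Finset.sum_add_distrib, Finset.mul_sum]
  refine Finset.sum_congr rfl fun i _ => Finset.sum_congr rfl fun j _ => ?_
  have e1 : u i * -u j + v i * -v j = -(u i * u j + v i * v j) := by ring
  have e2 : -u i * u j + -v i * v j = -(u i * u j + v i * v j) := by ring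
  have e3 : -u i * -u j + -v i * -v j = u i * u j + v i * v j := by ring
  rw [e1, e2, e3, hneg]
  linear_combination c i * c j * h (u i * u j + v i * v j) * he

/-- If all degrees `k + l` of sign parity `e` with `a_k b_l > 0` are bounded, then some configuration
of antipodal pairs annihilates the form of the product. -/
theorem not_isIsotropicPartSPD_mul (hd : 2 ≤ d) (ha : IsGegenbauerExpansion d f a)
    (hb : IsGegenbauerExpansion d g b) (e : ℝ) (he : e = 1 ∨ e = -1) (K : ℕ)
    (hK : ∀ k l, 0 < a k * b l → (-1 : ℝ) ^ (k + l) = e → k + l < K) :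
    ¬ IsIsotropicPartSPD d fun t => f t * g t := by
  rintro ⟨-, hspd⟩
  obtain ⟨N, u, v, c, huv, hv, hu, hc, hmom⟩ := exists_circle_moments_zero K
  have he2 : e * e = 1 := by rcases he with rfl | rfl <;> norm_num
  set y := antipodalFamily (d := d) (by omega) huv with hy
  set C : Fin N ⊕ Fin N → ℝ := Sum.elim c (fun i => e * c i) with hC
  have hyinj : Function.Injective y := antipodalFamily_injective _ huv hv hu
  have hform : sphereForm (fun t => f t * g t) y C = 0 := by
    have hsum := hasSum_sphereForm_mul ha hb y C
    refine hsum.unique ?_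
    convert hasSum_zero with p
    obtain ⟨k, l⟩ := p
    simp only
    rcases eq_or_lt_of_le (mul_nonneg (ha.1 k) (hb.1 l)) with h0 | h0
    · rw [← h0, zero_mul]
    refine mul_eq_zero_of_right _ ?_
    set P := sphereGegenbauer d k * sphereGegenbauer d l with hP
    have hneg : ∀ t, P.eval (-t) = (-1) ^ (k + l) * P.eval t := by
      intro t
      simp only [hP, eval_mul, sphereGegenbauer, gegenbauerPoly_eval_neg, pow_add]
      ring
    have hexp : sphereForm (fun t => (sphereGegenbauer d k).eval t *
        (sphereGegenbauer d l).eval t) y C =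
        (2 + 2 * e * (-1) ^ (k + l)) *
          ∑ i, c i * ∑ j, c j * P.eval (u i * u j + v i * v j) := by
      simp only [← eval_mul]
      exact sphereForm_antipodalFamily _ huv c he2 hneg
    rw [hexp]
    -- For parity `e` the degree is below `K` and the moments kill each inner sum; for the opposite
    -- parity the prefactor is `2 - 2 * e * e = 0`.
    by_cases hpar : (-1 : ℝ) ^ (k + l) = e
    · refine mul_eq_zero_of_right _ (Finset.sum_eq_zero fun i _ => mul_eq_zero_of_right _ ?_)
      refine sum_eval_eq_zero_of_moments hmom ?_ _ _
      have := natDegree_mul_le (p := sphereGegenbauer d k) (q := sphereGegenbauer d l)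
      have h1 := natDegree_gegenbauerPoly_le (((d : ℝ) - 1) / 2) k
      have h2 := natDegree_gegenbauerPoly_le (((d : ℝ) - 1) / 2) l
      have h3 := hK k l h0 hpar
      simp only [sphereGegenbauer] at this
      simp only [hP, sphereGegenbauer]
      omega
    · refine mul_eq_zero_of_left ?_ _
      have : (-1 : ℝ) ^ (k + l) = -e := by
        rcases neg_one_pow_eq_or ℝ (k + l) with h | h <;> rcases he with he' | he' <;>
          rw [h, he'] at hpar ⊢
        · exact absurd rfl hpar
        · norm_num
        · exact absurd rfl hpar
      rw [this]
      linear_combination -2 * he2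
  have hCne : C ≠ 0 := by
    intro h
    apply hc
    ext i
    simpa [hC] using congrFun h (Sum.inl i)
  have hpos := hspd _ (y ∘ (Fintype.equivFin _).symm) (hyinj.comp (Equiv.injective _))
    (C ∘ (Fintype.equivFin _).symm) (by
      intro h
      apply hCne
      ext i
      simpa using congrFun h (Fintype.equivFin _ i))
  simp only [isotropicKernel_eq_sphereInner] at hpos
  change 0 < sphereForm (fun t => f t * g t) _ _ at hpos
  rw [sphereForm_reindex, hform] at hpos
  exact lt_irrefl _ hpos

theorem infinite_of_isIsotropicPartSPD_mul (hd : 2 ≤ d) (ha : IsGegenbauerExpansion d f a)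
    (hb : IsGegenbauerExpansion d g b) (h : IsIsotropicPartSPD d fun t => f t * g t)
    {e : ℝ} (he : e = 1 ∨ e = -1) :
    {m ∈ sumSupport a b | (-1 : ℝ) ^ m = e}.Infinite := by
  intro hfin
  obtain ⟨K, hK⟩ := hfin.bddAbove
  refine not_isIsotropicPartSPD_mul hd ha hb e he (K + 1) (fun k l hkl hpar => ?_) h
  exact Nat.lt_succ_of_le (hK ⟨⟨k, l, hkl, rfl⟩, hpar⟩)

end Strict

theorem theorem2p6 (d : ℕ) (hd : 2 ≤ d) (f g : ℝ → ℝ)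
    (hf : IsIsotropicPartPD d f) (hg : IsIsotropicPartPD d g) :
    (∃ a : ℕ → ℝ, IsGegenbauerExpansion d f a) ∧
    (∃ b : ℕ → ℝ, IsGegenbauerExpansion d g b) ∧
    ∀ a b : ℕ → ℝ, IsGegenbauerExpansion d f a → IsGegenbauerExpansion d g b →
      (IsIsotropicPartSPD d (fun t => f t * g t) ↔
        {m ∈ sumSupport a b | Even m}.Infinite ∧ {m ∈ sumSupport a b | Odd m}.Infinite) := by
  refine ⟨hf.exists_isGegenbauerExpansion hd, hg.exists_isGegenbauerExpansion hd,
    fun a b ha hb => ⟨fun h => ⟨?_, ?_⟩, fun h =>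
      isIsotropicPartSPD_mul_of_infinite hd hf hg ha hb h.1 h.2⟩⟩
  · simpa only [neg_one_pow_eq_one_iff_even (by norm_num : (-1 : ℝ) ≠ 1)] using
      infinite_of_isIsotropicPartSPD_mul hd ha hb h (Or.inl rfl)
  · simpa only [neg_one_pow_eq_neg_one_iff_odd (by norm_num : (-1 : ℝ) ≠ 1)] using
      infinite_of_isIsotropicPartSPD_mul hd ha hb h (Or.inr rfl)
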